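/- Identify $\mathbb{R}^3$ with the space of pure quaternions $z=x_1\mathbf i+x_2\mathbf j+x_3\mathbf k$, so that $S^2$ is the set of pure unit quaternions. Let $f(r)=(2\pi)^{-3/2}e^{-r^2/2}$ and let $d\mu(z)=f(|z|)\,dm(z)$ be the standard Gaussian measure on $\mathbb{R}^3$, where $m$ is Lebesgue measure. On the right $\mathbb{H}$-module of polynomial functions $\sum_k z^k a_k$ ($a_k\in\mathbb{H}$) on the pure quaternions, consider the quaternion-valued scalar product $\langle p,q\rangle=\int_{\mathbb{R}^3}\overline{p(z)}\,q(z)\,d\mu(z)$. Let $P_0,P_1,P_2,\dots$ be the monic orthogonal polynomials for this scalar product ($P_k$ of degree $k$, obtained from $1,z,z^2,\dots$ by Gram–Schmidt orthogonalization), let $h_k=\langle P_k,P_k\rangle>0$, and let $$K_n(x,y)=\sum_{k=0}^{n}\frac{P_k(x)\,\overline{P_k(y)}}{h_k}.$$ Put $\rho(s)=\frac{1}{(2\pi)^2}\frac{\sqrt{1-s^2}}{s^2}$ for $s\in(0,1)$. Theorem. Let $\varepsilon>0$, $x_0\in[\varepsilon,1-\varepsilon]$, $\phi=\arccos x_0$,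 $\sigma,\tau\in\mathbb{R}$ and $u,v\in S^2$. For $n\ge 1$ let $$s_n=2\sqrt{n+\tfrac32}\,\cos\Big(\phi+\frac{\sigma}{2\sin^2\phi}\cdot\frac1n\Big),\qquad t_n=2\sqrt{n+\tfrac32}\,\cos\Big(\phi+\frac{\tau}{2\sin^2\phi}\cdot\frac1n\Big).$$ Then $$\lim_{n\to\infty}\frac{2\sqrt{n+\frac32}}{\rho(x_0)}\,K_n(us_n,vt_n)\,\sqrt{f(s_n)f(t_n)}=\frac{\sin(\tau-\sigma)}{\tau-\sigma}\cdot\frac{1-uv}{2},$$ where $uv$ is the quaternion product and $\frac{\sin(\tau-\sigma)}{\tau-\sigma}$ is read as $1$ if $\sigma=\tau$. -/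

import Mathlib

open Quaternion

namespace Ginibre3D

noncomputable section

/-- Three-dimensional Euclidean space, identified with the space of pure quaternions by `toQuat`. -/
abbrev Space : Type := EuclideanSpace ℝ (Fin 3)

/-- The pure quaternion `x₁ i + x₂ j + x₃ k`. -/
def toQuat (x : Space) : ℍ[ℝ] := ⟨0, x 0, x 1, x 2⟩

/-- The density of the background measure as a function of the radius. -/
def density (r : ℝ) : ℝ := (2 * Real.pi) ^ (-(3 / 2 : ℝ)) * Real.exp (-r ^ 2 / 2)

/-- The background measure: the standard Gaussian measure on `ℝ³`. -/
def background : MeasureTheory.Measure Space :=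
  MeasureTheory.volume.withDensity fun z => ENNReal.ofReal (density ‖z‖)

/-- The quaternion-valued scalar product of quaternion functions; it is right-linear in the
second argument. -/
def scalarProd (p q : Space → ℍ[ℝ]) : ℍ[ℝ] := ∫ z, star (p z) * q z ∂background

/-- The monic orthogonal polynomials on the pure quaternions, with respect to `scalarProd`:
Gram-Schmidt orthogonalization, without normalization, of `1, z, z², …` in the right
`ℍ`-module of polynomial functions `∑ zᵏ aₖ`. -/
def orthoPoly (n : ℕ) (z : Space) : ℍ[ℝ] :=
  toQuat z ^ n - ∑ k : Fin n, orthoPoly k z *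
    ((scalarProd (orthoPoly k) (orthoPoly k))⁻¹ *
      scalarProd (orthoPoly k) (fun w => toQuat w ^ n))
termination_by n
decreasing_by all_goals exact k.isLt

/-- The squared norm `⟨Pₖ, Pₖ⟩`, a quaternion with vanishing imaginary part, as a real number. -/
def sqNorm (k : ℕ) : ℝ := (scalarProd (orthoPoly k) (orthoPoly k)).re

/-- The kernel `Kₙ(x, y)`, the sum over `0 ≤ k ≤ n`. -/
def kernel (n : ℕ) (x y : Space) : ℍ[ℝ] :=
  ∑ k ∈ Finset.range (n + 1), (sqNorm k)⁻¹ • (orthoPoly k x * star (orthoPoly k y))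

/-- The limiting density at rescaled radius `s ∈ (0, 1)`. -/
def limitDensity (s : ℝ) : ℝ := 1 / (2 * Real.pi) ^ 2 * (√(1 - s ^ 2) / s ^ 2)

/-- The radius `2 √(n + 3/2) cos (φ + σ / (2 sin² φ) · 1/n)`, where `φ = arccos x₀`. -/
def radius (x₀ σ : ℝ) (n : ℕ) : ℝ :=
  2 * √((n : ℝ) + 3 / 2) *
    Real.cos (Real.arccos x₀ + σ / (2 * Real.sin (Real.arccos x₀) ^ 2) * (1 / (n : ℝ)))

/-- The rescaled kernel near the rescaled radius `x₀`. -/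
def rescaledKernel (n : ℕ) (u : Space) (σ : ℝ) (v : Space) (τ : ℝ) (x₀ : ℝ) : ℍ[ℝ] :=
  (2 * √((n : ℝ) + 3 / 2) / limitDensity x₀ *
      √(density (radius x₀ σ n) * density (radius x₀ τ n))) •
    kernel n (radius x₀ σ n • u) (radius x₀ τ n • v)

/-- The limit kernel on `S² × ℝ`; `Real.sinc x` is `sin x / x`, with value `1` at `0`. -/
def limitKernel (u : Space) (σ : ℝ) (v : Space) (τ : ℝ) : ℍ[ℝ] :=
  Real.sinc (τ - σ) • ((1 - toQuat u * toQuat v) / 2)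

end

end Ginibre3D

namespace Ginibre3D

/-! ### Hermite polynomials of imaginary argument and orthogonality for `x² exp (-x² / 2)` -/

noncomputable section

open Polynomial

/-! A pure quaternion is `s q` with `q ^ 2 = -1`, so a real polynomial in it behaves like one
evaluated on the imaginary axis. In polar coordinates the Jacobian turns the Gaussian on `ℝ³` into
the one-dimensional weight `x² exp (-x² / 2)`. The `Pₖ` are therefore the generalized Hermite
polynomials of imaginary argument, with real coefficients (`orthoPoly_eq`), and they are explicit
combinations of classical Hermite polynomials divided by `X ^ 2` (`X_sq_mul_genHermite`).

Along rays through unit `u`, `v`, the even degrees contribute multiples of `1` and the odd degrees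
multiples of `-uv` (`kernel_smul_smul`). After multiplication by `s t`, the even-degree part is the
odd part of the classical Hermite kernel `H` of degree `n + 1`, namely `(H(s,t) - H(s,-t)) / 2`. The
odd-degree part is `(H(s,t) + H(s,-t)) / 2` up to a rank-one term (`mul_evenKernel`,
`mul_oddKernel`). In the bulk, `H(s,-t)` and the rank-one term are negligible, so both coefficients
have the same limit `sinc (τ - σ) / 2`, whence the factor `(1 - uv) / 2`.

The asymptotics of `H(s,t)` need no Plancherel-Rotach formula. The Christoffel-Darboux formula
expresses `H` through the Hermite function `f` and `f'`, where `f'' = -(l - x² / 4) f`. Freezing the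
frequency over the short interval between `s` and `t` turns the bracket `f(s) f'(t) - f'(s) f(t)`
into a sine whose amplitude is the adiabatic invariant `w f² + f'² / w`, with `w` the local
frequency (`abs_bracket_sub_le`). This invariant is constant through the bulk up to a relative error
`O(1 / l)` (`action_bounds`), so it can be read off at `0`, where Hermite values are known and
Wallis' product gives the limit `√(2 / π)` (`tendsto_action_zero`). Phase and amplitude never have
to be known separately. -/

/-- The monic Hermite polynomials of imaginary argument, `iⁿ Heₙ(-i X)`. -/
def imagHermite : ℕ → ℝ[X]
  | 0 => 1
  | 1 => X
  | n + 2 => X * imagHermite (n + 1) + C ((n : ℝ) + 1) * imagHermite n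

/-- The coefficient in the relation of the generalized to the classical Hermite polynomials. -/
def shiftCoeff (n : ℕ) : ℝ := if Even n then (n : ℝ) + 1 else (n : ℝ) + 2

/-- The recurrence coefficients of the generalized Hermite polynomials. -/
def recCoeff (n : ℕ) : ℝ := if Even n then (n : ℝ) else (n : ℝ) + 2

/-- The monic generalized Hermite polynomials for the weight `x² exp (-x² / 2)`, of imaginary
argument. -/
def genHermite : ℕ → ℝ[X]
  | 0 => 1
  | 1 => X
  | n + 2 => X * genHermite (n + 1) + C (recCoeff (n + 1)) * genHermite n

theorem imagHermite_add_two (n : ℕ) :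
    imagHermite (n + 2) = X * imagHermite (n + 1) + C ((n : ℝ) + 1) * imagHermite n := by
  rw [imagHermite]

theorem genHermite_add_two (n : ℕ) :
    genHermite (n + 2) = X * genHermite (n + 1) + C (recCoeff (n + 1)) * genHermite n := by
  rw [genHermite]

theorem derivative_imagHermite_succ (n : ℕ) :
    derivative (imagHermite (n + 1)) = C ((n : ℝ) + 1) * imagHermite n := by
  induction n using Nat.strong_induction_on with
  | _ n ih =>
    match n with
    | 0 => simp [imagHermite]
    | 1 =>
      simp only [imagHermite, derivative_mul, derivative_X, derivative_one, map_add, map_one,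
        Nat.cast_one, Nat.cast_zero, map_zero]
      ring
    | n + 2 =>
      rw [imagHermite_add_two (n + 1)]
      simp only [derivative_add, derivative_mul, derivative_X, derivative_C]
      rw [ih (n + 1) (by omega), ih n (by omega), imagHermite_add_two n]
      simp only [Nat.cast_add, Nat.cast_one, Nat.cast_ofNat, map_add, map_one, map_ofNat]
      ring

theorem imagHermite_succ (n : ℕ) :
    imagHermite (n + 1) = X * imagHermite n + derivative (imagHermite n) := by
  cases n with
  | zero => simp [imagHermite]
  | succ n => rw [derivative_imagHermite_succ, imagHermite_add_two]

/-- Both sides obey the same three-term recurrence. This is the Christoffel formula for multiplying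
a weight by `x²`; it reduces everything about `genHermite` to classical Hermite polynomials. -/
theorem X_sq_mul_genHermite (n : ℕ) :
    X ^ 2 * genHermite n = imagHermite (n + 2) - C (shiftCoeff n) * imagHermite n := by
  induction n using Nat.strong_induction_on with
  | _ n ih =>
    match n with
    | 0 => simp [imagHermite, genHermite, shiftCoeff]; ring
    | 1 =>
      simp [imagHermite, genHermite, shiftCoeff]
      rw [show (C (2 : ℝ)) = (2 : ℝ[X]) from rfl]
      ring
    | n + 2 =>
      have h1 := ih (n + 1) (by omega)
      have h0 := ih n (by omega)
      have e : X ^ 2 * genHermite (n + 2) = X * (X ^ 2 * genHermite (n + 1)) +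
          C (recCoeff (n + 1)) * (X ^ 2 * genHermite n) := by
        rw [genHermite_add_two]; ring
      rw [e, h1, h0]
      rw [imagHermite_add_two (n + 2), show n + 2 + 1 = n + 1 + 2 by ring,
        imagHermite_add_two (n + 1), imagHermite_add_two n]
      -- Expanding in the `imagHermite` family, `key1` matches the coefficients of `imagHermite (n +
      -- 2)`, and `key2` makes the coefficient of `imagHermite n` vanish.
      have key1 : shiftCoeff (n + 2) = shiftCoeff (n + 1) - recCoeff (n + 1) + (n + 1 + 1 + 1) := by
        unfold shiftCoeff recCoeff
        by_cases h : Even n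
        · simp [h, parity_simps]; ring
        · simp [h, parity_simps]; ring
      have key2 : shiftCoeff (n + 1) * ((n : ℝ) + 1) = recCoeff (n + 1) * shiftCoeff n := by
        unfold shiftCoeff recCoeff
        by_cases h : Even n
        · simp [h, parity_simps]
        · simp [h, parity_simps]
          ring
      have key2' := congrArg (C : ℝ → ℝ[X]) key2
      rw [key1]
      simp only [C_mul, C_add, C_sub, C_1, Nat.cast_add, Nat.cast_one, Nat.cast_ofNat, map_ofNat]
        at key2' ⊢
      linear_combination imagHermite n * key2'

theorem genHermite_monic_natDegree (n : ℕ) :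
    (genHermite n).Monic ∧ (genHermite n).natDegree = n := by
  induction n using Nat.strong_induction_on with
  | _ n ih =>
    match n with
    | 0 => simp [genHermite]
    | 1 => simp [genHermite, monic_X]
    | n + 2 =>
      obtain ⟨m1, d1⟩ := ih (n + 1) (by omega)
      obtain ⟨m0, d0⟩ := ih n (by omega)
      rw [genHermite_add_two]
      have hm : (X * genHermite (n + 1)).Monic := monic_X.mul m1
      have hd : (X * genHermite (n + 1)).natDegree = n + 2 := by
        rw [monic_X.natDegree_mul m1, natDegree_X, d1]; ring
      have hlt : (C (recCoeff (n + 1)) * genHermite n).natDegree < n + 2 :=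
        (natDegree_C_mul_le _ _).trans_lt (by omega)
      have hlt' : (C (recCoeff (n + 1)) * genHermite n).degree <
          (X * genHermite (n + 1)).degree :=
        degree_lt_degree (by rw [hd]; exact hlt)
      exact ⟨hm.add_of_left hlt', by rw [natDegree_add_eq_left_of_natDegree_lt (by omega), hd]⟩

theorem genHermite_monic (n : ℕ) : (genHermite n).Monic := (genHermite_monic_natDegree n).1

theorem natDegree_genHermite (n : ℕ) : (genHermite n).natDegree = n :=
  (genHermite_monic_natDegree n).2

theorem genHermite_degree (n : ℕ) : (genHermite n).degree = n := by
  rw [degree_eq_natDegree (genHermite_monic n).ne_zero, natDegree_genHermite]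

theorem exists_eq_sum_genHermite (n : ℕ) (q : ℝ[X]) (hq : q.degree < n) :
    ∃ a : ℕ → ℝ, q = ∑ k ∈ Finset.range n, C (a k) * genHermite k := by
  induction n generalizing q with
  | zero => exact ⟨0, by simpa [Nat.WithBot.lt_zero_iff] using hq⟩
  | succ n ih =>
    obtain ⟨a, ha⟩ := ih (q - C (q.coeff n) * genHermite n) (by
      rw [degree_lt_iff_coeff_zero]
      intro m hm
      rcases hm.eq_or_lt with rfl | hm
      · have : (genHermite n).coeff n = 1 := by
          have := (genHermite_monic n).coeff_natDegree
          rwa [natDegree_genHermite] at this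
        simp [this]
      · have h1 : q.coeff m = 0 := coeff_eq_zero_of_degree_lt (hq.trans_le (by exact_mod_cast hm))
        have h2 : (genHermite n).coeff m = 0 :=
          coeff_eq_zero_of_natDegree_lt (by rwa [natDegree_genHermite])
        simp [h1, h2])
    refine ⟨fun k => if k = n then q.coeff n else a k, ?_⟩
    rw [Finset.sum_range_succ]
    dsimp only
    rw [if_pos rfl]
    have : ∑ k ∈ Finset.range n, C (if k = n then q.coeff n else a k) * genHermite k =
        ∑ k ∈ Finset.range n, C (a k) * genHermite k :=
      Finset.sum_congr rfl fun k hk => by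
        rw [if_neg (Finset.mem_range.1 hk).ne]
    rw [this, ← ha]; ring

/-- The moments of the standard Gaussian measure on the imaginary axis. -/
def imagMoment : ℕ → ℝ
  | 0 => 1
  | 1 => 0
  | n + 2 => -((n : ℝ) + 1) * imagMoment n

/-- The moment functional of the standard Gaussian measure on the imaginary axis. -/
def imagGauss : ℝ[X] →ₗ[ℝ] ℝ := (basisMonomials ℝ).constr ℝ imagMoment

theorem imagGauss_monomial (n : ℕ) (a : ℝ) : imagGauss (monomial n a) = a * imagMoment n := by
  have h : imagGauss (monomial n 1) = imagMoment n := by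
    have := (basisMonomials ℝ).constr_basis ℝ imagMoment n
    rwa [coe_basisMonomials] at this
  rw [← mul_one a, ← smul_eq_mul, ← smul_monomial, map_smul, h]; simp

/-- Gaussian integration by parts; the sign is reversed because the variable is imaginary. -/
theorem imagGauss_X_mul (q : ℝ[X]) : imagGauss (X * q) = -imagGauss (derivative q) := by
  induction q using Polynomial.induction_on' with
  | add p q hp hq => simp only [mul_add, map_add, hp, hq]; ring
  | monomial n a =>
    rw [X_mul_monomial, derivative_monomial, imagGauss_monomial, imagGauss_monomial]
    cases n with
    | zero => simp [imagMoment]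
    | succ n => simp [imagMoment]; ring

/-- Rodrigues' formula in weak form: in each integration by parts the term with the derivative of
`imagHermite n` cancels, and one derivative passes to `q`. -/
theorem imagGauss_imagHermite_mul (n : ℕ) (q : ℝ[X]) :
    imagGauss (imagHermite n * q) = (-1) ^ n * imagGauss (derivative^[n] q) := by
  induction n generalizing q with
  | zero => simp [imagHermite]
  | succ n ih =>
    have e : imagHermite (n + 1) * q =
        X * (imagHermite n * q) + derivative (imagHermite n) * q := by
      rw [imagHermite_succ]; ring
    rw [e, map_add, imagGauss_X_mul, derivative_mul, map_add, ih, Function.iterate_succ_apply]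
    ring

/-- The moment functional of the background measure along powers of a pure quaternion. -/
def backMoment : ℝ[X] →ₗ[ℝ] ℝ := -(imagGauss ∘ₗ LinearMap.mulLeft ℝ (X ^ 2))

theorem backMoment_apply (q : ℝ[X]) : backMoment q = -imagGauss (X ^ 2 * q) := rfl

/-- Of the two terms of `X ^ 2 * genHermite n`, the one of degree `n + 2` is orthogonal to `q`.
Orthogonality and the norms both follow from this formula. -/
theorem backMoment_genHermite_mul (n : ℕ) (q : ℝ[X]) (hq : q.natDegree ≤ n) :
    backMoment (genHermite n * q) =
      shiftCoeff n * ((-1) ^ n * imagGauss (derivative^[n] q)) := by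
  have e : X ^ 2 * (genHermite n * q) =
      imagHermite (n + 2) * q - shiftCoeff n • (imagHermite n * q) := by
    rw [← mul_assoc, X_sq_mul_genHermite, smul_eq_C_mul]; ring
  rw [backMoment_apply, e, map_sub, map_smul, imagGauss_imagHermite_mul,
    imagGauss_imagHermite_mul, iterate_derivative_eq_zero (by omega)]
  simp

theorem backMoment_genHermite_mul_of_lt {n : ℕ} {q : ℝ[X]} (hq : q.natDegree < n) :
    backMoment (genHermite n * q) = 0 := by
  rw [backMoment_genHermite_mul n q hq.le, iterate_derivative_eq_zero hq]; simp

theorem backMoment_genHermite_mul_genHermite_of_ne {j k : ℕ} (h : j ≠ k) :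
    backMoment (genHermite j * genHermite k) = 0 := by
  rcases h.lt_or_gt with h | h
  · rw [mul_comm]; exact backMoment_genHermite_mul_of_lt (by rwa [natDegree_genHermite])
  · exact backMoment_genHermite_mul_of_lt (by rwa [natDegree_genHermite])

theorem backMoment_genHermite_mul_self (n : ℕ) :
    backMoment (genHermite n * genHermite n) = (-1) ^ n * (shiftCoeff n * n.factorial) := by
  rw [backMoment_genHermite_mul n _ (natDegree_genHermite n).le]
  have h : derivative^[n] (genHermite n) = monomial 0 (n.factorial : ℝ) := by
    ext m
    rw [coeff_iterate_derivative, coeff_monomial]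
    rcases Nat.eq_zero_or_pos m with rfl | hm
    · have := (genHermite_monic n).coeff_natDegree
      rw [natDegree_genHermite] at this
      simp [this, Nat.descFactorial_self]
    · rw [coeff_eq_zero_of_natDegree_lt (by rw [natDegree_genHermite]; omega)]
      simp [hm.ne]
  rw [h, imagGauss_monomial]
  simp [imagMoment]; ring

theorem shiftCoeff_pos (n : ℕ) : 0 < shiftCoeff n := by
  unfold shiftCoeff; split_ifs <;> positivity

end

/-! ### Gaussian integrals on the pure quaternions and identification of `orthoPoly` -/

noncomputable section

open Polynomial MeasureTheory

@[simp] theorem re_toQuat (z : Space) : (toQuat z).re = 0 := rfl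

@[simp] theorem imI_toQuat (z : Space) : (toQuat z).imI = z 0 := rfl

@[simp] theorem imJ_toQuat (z : Space) : (toQuat z).imJ = z 1 := rfl

@[simp] theorem imK_toQuat (z : Space) : (toQuat z).imK = z 2 := rfl

theorem norm_toQuat (z : Space) : ‖toQuat z‖ = ‖z‖ := by
  have h : ‖toQuat z‖ ^ 2 = ‖z‖ ^ 2 := by
    rw [pow_two, ← normSq_eq_norm_mul_self, normSq_def', EuclideanSpace.real_norm_sq_eq,
      Fin.sum_univ_three]
    simp
  exact (sq_eq_sq₀ (norm_nonneg _) (norm_nonneg _)).1 h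

theorem toQuat_smul (s : ℝ) (z : Space) : toQuat (s • z) = s • toQuat z := by
  ext <;> simp

theorem toQuat_neg (z : Space) : toQuat (-z) = -toQuat z := by
  ext <;> simp

theorem star_toQuat (z : Space) : star (toQuat z) = -toQuat z := by
  ext <;> simp

theorem toQuat_sq (z : Space) : toQuat z ^ 2 = ((-‖z‖ ^ 2 : ℝ) : ℍ[ℝ]) := by
  have h := self_mul_star (toQuat z)
  rw [star_toQuat, normSq_eq_norm_mul_self, norm_toQuat, mul_neg, neg_eq_iff_eq_neg] at h
  rw [pow_two, h, pow_two, Quaternion.coe_neg]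

theorem continuous_toQuat : Continuous toQuat := by
  have h : LipschitzWith 1 toQuat := LipschitzWith.of_dist_le_mul fun x y => by
    have e : toQuat x - toQuat y = toQuat (x - y) := by ext <;> simp
    rw [dist_eq_norm, e, norm_toQuat, dist_eq_norm]; simp
  exact h.continuous

theorem density_pos (r : ℝ) : 0 < density r := by
  unfold density; positivity

theorem continuous_density : Continuous density := by
  unfold density; fun_prop

theorem background_eq : background =
    volume.withDensity fun z : Space => ((density ‖z‖).toNNReal : ENNReal) := rfl

theorem measurable_density_norm : Measurable fun z : Space => (density ‖z‖).toNNReal :=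
  (continuous_density.comp continuous_norm).measurable.real_toNNReal

theorem integral_background {E : Type*} [NormedAddCommGroup E] [NormedSpace ℝ E]
    (g : Space → E) : ∫ z, g z ∂background = ∫ z, density ‖z‖ • g z := by
  rw [background_eq, integral_withDensity_eq_integral_smul measurable_density_norm]
  simp only [NNReal.smul_def, Real.coe_toNNReal _ (density_pos _).le]

theorem integrable_background {E : Type*} [NormedAddCommGroup E] [NormedSpace ℝ E]
    (g : Space → E) :
    Integrable g background ↔ Integrable (fun z => density ‖z‖ • g z) := by
  rw [background_eq, integrable_withDensity_iff_integrable_smul measurable_density_norm]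
  simp only [NNReal.smul_def, Real.coe_toNNReal _ (density_pos _).le]

theorem integrable_norm_pow_background (k : ℕ) :
    Integrable (fun z : Space => ‖z‖ ^ k) background := by
  rw [integrable_background]
  refine (integrable_fun_norm_addHaar volume (E := Space)
    (f := fun r => density r • r ^ k)).2 ?_
  have h := (integrable_rpow_mul_exp_neg_mul_sq (b := 1 / 2) (by norm_num)
    (s := ((k + 2 : ℕ) : ℝ)) (by push_cast; linarith [k.cast_nonneg (α := ℝ)])).integrableOn
    (s := Set.Ioi 0)
  refine (h.const_mul ((2 * Real.pi) ^ (-(3 / 2 : ℝ)))).congr ?_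
  refine Filter.Eventually.of_forall fun r => ?_
  simp only [finrank_euclideanSpace, Fintype.card_fin, smul_eq_mul, density, Real.rpow_natCast]
  rw [show -(1 / 2 : ℝ) * r ^ 2 = -r ^ 2 / 2 by ring]
  ring

theorem integral_norm_pow_background (k : ℕ) :
    ∫ z : Space, ‖z‖ ^ k ∂background =
      4 * Real.pi * (2 * Real.pi) ^ (-(3 / 2 : ℝ)) *
        ((1 / 2 : ℝ) ^ (-((k : ℝ) + 3) / 2) * (1 / 2) * Real.Gamma (((k : ℝ) + 3) / 2)) := by
  rw [integral_background]
  have hb : (volume : Measure Space).real (Metric.ball 0 1) = Real.pi * 4 / 3 := by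
    rw [Measure.real, EuclideanSpace.volume_ball_fin_three]
    simp
    positivity
  have h := integral_fun_norm_addHaar (volume : Measure Space) fun r => density r • r ^ k
  have hG := integral_rpow_mul_exp_neg_mul_rpow (p := 2) (q := (k : ℝ) + 2) (b := 1 / 2)
    (by norm_num) (by linarith [k.cast_nonneg (α := ℝ)]) (by norm_num)
  have hcongr : ∫ y in Set.Ioi (0 : ℝ), y ^ (Module.finrank ℝ Space - 1) • density y • y ^ k =
      (2 * Real.pi) ^ (-(3 / 2 : ℝ)) *
        ∫ x in Set.Ioi (0 : ℝ), x ^ ((k : ℝ) + 2) * Real.exp (-(1 / 2) * x ^ (2 : ℝ)) := by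
    rw [← integral_const_mul]
    refine setIntegral_congr_fun measurableSet_Ioi fun x (hx : 0 < x) => ?_
    have e : x ^ ((k : ℝ) + 2) = x ^ k * x ^ 2 := by
      rw [Real.rpow_add hx, Real.rpow_natCast, Real.rpow_ofNat]
    simp only [finrank_euclideanSpace, Fintype.card_fin, smul_eq_mul, density, e,
      Real.rpow_ofNat]
    rw [show -(1 / 2 : ℝ) * x ^ 2 = -x ^ 2 / 2 by ring]
    ring
  rw [h, hb, hcongr, hG, finrank_euclideanSpace, Fintype.card_fin,
    show (k : ℝ) + 2 + 1 = k + 3 by ring]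
  simp only [nsmul_eq_mul, smul_eq_mul]
  push_cast
  ring

/-- The Gamma recursion produces the same factor `2 j + 3` as the recursion of the moments. The
shift by `2` is the Jacobian `r²`, and the minus sign is that of `X ^ 2 = -r²` on the imaginary
axis. -/
theorem integral_norm_pow_even (j : ℕ) :
    (-1) ^ j * ∫ z : Space, ‖z‖ ^ (2 * j) ∂background = -imagMoment (2 * j + 2) := by
  induction j with
  | zero =>
    rw [integral_norm_pow_background]
    have h2 : (0 : ℝ) < 2 := by norm_num
    have hG : Real.Gamma (3 / 2) = 1 / 2 * √Real.pi := by
      rw [show (3 / 2 : ℝ) = 1 / 2 + 1 by norm_num, Real.Gamma_add_one (by norm_num),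
        Real.Gamma_one_half_eq]
    have hpi : Real.pi ^ (-(3 / 2 : ℝ)) * Real.pi * √Real.pi = 1 := by
      rw [Real.sqrt_eq_rpow]
      nth_rewrite 2 [← Real.rpow_one Real.pi]
      rw [← Real.rpow_add Real.pi_pos, ← Real.rpow_add Real.pi_pos]
      norm_num
    have htwo : (2 : ℝ) ^ (-(3 / 2 : ℝ)) * (1 / 2 : ℝ) ^ (-(3 : ℝ) / 2) = 1 := by
      rw [one_div, Real.inv_rpow h2.le, show -(3 : ℝ) / 2 = -(3 / 2) by ring,
        mul_inv_cancel₀ (by positivity)]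
    simp only [mul_zero, Nat.cast_zero, zero_add, pow_zero, one_mul, imagMoment, hG]
    rw [Real.mul_rpow h2.le Real.pi_pos.le]
    linear_combination ((2 : ℝ) ^ (-(3 / 2 : ℝ)) * (1 / 2 : ℝ) ^ (-(3 : ℝ) / 2)) * hpi + htwo
  | succ j ih =>
    have e : ∫ z : Space, ‖z‖ ^ (2 * (j + 1)) ∂background =
        (2 * j + 3) * ∫ z : Space, ‖z‖ ^ (2 * j) ∂background := by
      rw [integral_norm_pow_background, integral_norm_pow_background]
      push_cast
      rw [show (2 * ((j : ℝ) + 1) + 3) / 2 = (2 * (j : ℝ) + 3) / 2 + 1 by ring,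
        Real.Gamma_add_one (by positivity),
        show -(2 * ((j : ℝ) + 1) + 3) / 2 = -(2 * (j : ℝ) + 3) / 2 + (-1 : ℝ) by ring,
        Real.rpow_add (by norm_num), Real.rpow_neg_one]
      ring
    rw [e, show 2 * (j + 1) + 2 = 2 * j + 2 + 2 by ring, imagMoment, pow_succ]
    push_cast
    linear_combination (-(2 * (j : ℝ) + 3)) * ih

theorem integrable_toQuat_pow (k : ℕ) : Integrable (fun z => toQuat z ^ k) background := by
  refine (integrable_norm_pow_background k).mono'
    (continuous_toQuat.pow k).aestronglyMeasurable ?_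
  exact Filter.Eventually.of_forall fun z => by rw [norm_pow, norm_toQuat]

theorem imagMoment_odd (j : ℕ) : imagMoment (2 * j + 1) = 0 := by
  induction j with
  | zero => rfl
  | succ j ih => rw [show 2 * (j + 1) + 1 = 2 * j + 1 + 2 by ring, imagMoment, ih, mul_zero]

/-- Even powers are real and radial; odd powers integrate to zero by the symmetry `z ↦ -z`. -/
theorem integral_toQuat_pow (k : ℕ) :
    ∫ z, toQuat z ^ k ∂background = ((-imagMoment (k + 2) : ℝ) : ℍ[ℝ]) := by
  obtain ⟨j, rfl | rfl⟩ := Nat.even_or_odd' k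
  · rw [← integral_norm_pow_even, ← integral_const_mul]
    have : ∀ z : Space, toQuat z ^ (2 * j) = (((-1) ^ j * ‖z‖ ^ (2 * j) : ℝ) : ℍ[ℝ]) := by
      intro z
      rw [pow_mul, toQuat_sq, ← Quaternion.coe_pow, neg_pow, pow_mul]
    simp only [this]
    have h := ((algebraMapCLM ℝ ℍ[ℝ])).integral_comp_comm
      ((integrable_norm_pow_background (2 * j)).const_mul ((-1) ^ j))
    exact h
  · have h : ∫ z, toQuat z ^ (2 * j + 1) ∂background =
        -∫ z, toQuat z ^ (2 * j + 1) ∂background := by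
      conv_lhs => rw [integral_background, ← integral_neg_eq_self]
      rw [integral_background, ← integral_neg]
      refine integral_congr_ae (Filter.Eventually.of_forall fun z => ?_)
      simp [toQuat_neg, Odd.neg_pow (odd_two_mul_add_one j)]
    rw [show 2 * j + 1 + 2 = 2 * (j + 1) + 1 by ring, imagMoment_odd]
    have h2 : (2 : ℝ) • ∫ z, toQuat z ^ (2 * j + 1) ∂background = 0 := by
      rw [two_smul]
      nth_rewrite 1 [h]
      exact neg_add_cancel _
    simpa using h2

theorem integrable_aeval_toQuat (q : ℝ[X]) :
    Integrable (fun z => aeval (toQuat z) q) background := by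
  induction q using Polynomial.induction_on' with
  | add p q hp hq =>
    simp only [map_add]
    exact hp.add hq
  | monomial n a =>
    simp only [aeval_monomial, ← Algebra.smul_def]
    exact (integrable_toQuat_pow n).smul a

theorem integral_aeval_toQuat (q : ℝ[X]) :
    ∫ z, aeval (toQuat z) q ∂background = (backMoment q : ℍ[ℝ]) := by
  induction q using Polynomial.induction_on' with
  | add p q hp hq =>
    simp only [map_add]
    rw [integral_add (integrable_aeval_toQuat p) (integrable_aeval_toQuat q), hp, hq, Quaternion.coe_add]
  | monomial n a =>
    simp only [aeval_monomial, ← Algebra.smul_def]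
    rw [integral_smul, integral_toQuat_pow, backMoment_apply, X_pow_mul_monomial,
      imagGauss_monomial, ← Quaternion.coe_smul, smul_eq_mul, mul_neg]

/-- Conjugation sends a pure quaternion to its negative, and `genHermite n` has the parity of `n`.
This turns the sesquilinear scalar product into the bilinear functional `backMoment`. -/
theorem star_aeval_genHermite (n : ℕ) (z : Space) :
    star (aeval (toQuat z) (genHermite n)) = (-1 : ℝ) ^ n • aeval (toQuat z) (genHermite n) := by
  induction n using Nat.strong_induction_on with
  | _ n ih =>
    match n with
    | 0 => simp [genHermite]
    | 1 => simp [genHermite, star_toQuat]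
    | n + 2 =>
      have h1 := ih (n + 1) (by omega)
      have h0 := ih n (by omega)
      have c : aeval (toQuat z) (genHermite (n + 1)) * toQuat z =
          toQuat z * aeval (toQuat z) (genHermite (n + 1)) := by
        have := congrArg (aeval (toQuat z)) (mul_comm (genHermite (n + 1)) X)
        simpa using this
      rw [genHermite_add_two, ← smul_eq_C_mul]
      simp only [map_add, map_mul, map_smul, aeval_X, star_add, star_mul, Quaternion.star_smul,
        h1, h0, star_toQuat, smul_mul_assoc, mul_neg, c]
      module

theorem scalarProd_genHermite (k : ℕ) (q : ℝ[X]) :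
    scalarProd (fun z => aeval (toQuat z) (genHermite k)) (fun z => aeval (toQuat z) q) =
      (((-1) ^ k * backMoment (genHermite k * q) : ℝ) : ℍ[ℝ]) := by
  unfold scalarProd
  simp only [star_aeval_genHermite, smul_mul_assoc, ← map_mul]
  rw [integral_smul, integral_aeval_toQuat, ← Quaternion.coe_smul, smul_eq_mul]

theorem scalarProd_genHermite_self (k : ℕ) :
    scalarProd (fun z => aeval (toQuat z) (genHermite k))
      (fun z => aeval (toQuat z) (genHermite k)) =
      ((shiftCoeff k * k.factorial : ℝ) : ℍ[ℝ]) := by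
  rw [scalarProd_genHermite, backMoment_genHermite_mul_self, ← mul_assoc, ← mul_pow]
  norm_num

/-- The Gram-Schmidt coefficients are real, hence central: they are the coefficients `a k` of `X ^ n
- genHermite n` in the lower generalized Hermite polynomials. Multiplication on the right therefore
causes no trouble. -/
theorem orthoPoly_eq (n : ℕ) :
    orthoPoly n = fun z => aeval (toQuat z) (genHermite n) := by
  induction n using Nat.strong_induction_on with
  | _ n ih =>
    obtain ⟨a, ha⟩ := exists_eq_sum_genHermite n (X ^ n - genHermite n) (by
      have := degree_sub_lt_left (p := (X : ℝ[X]) ^ n) (q := genHermite n)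
        (by rw [degree_X_pow, genHermite_degree]) (monic_X_pow n).ne_zero
        (by rw [(monic_X_pow n).leadingCoeff, (genHermite_monic n).leadingCoeff])
      rwa [degree_X_pow] at this)
    have hX : (X : ℝ[X]) ^ n =
        genHermite n + ∑ k ∈ Finset.range n, C (a k) * genHermite k := by rw [← ha]; ring
    have hpow : (fun w => toQuat w ^ n) = fun w => aeval (toQuat w) ((X : ℝ[X]) ^ n) := by
      simp
    have hcoef : ∀ k : Fin n, (scalarProd (orthoPoly k) (orthoPoly k))⁻¹ *
        scalarProd (orthoPoly k) (fun w => toQuat w ^ n) = (a k : ℍ[ℝ]) := by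
      intro k
      have hk : shiftCoeff k * (Nat.factorial k : ℝ) ≠ 0 :=
        (mul_pos (shiftCoeff_pos k) (by positivity)).ne'
      have hm : (-1) ^ (k : ℕ) * backMoment (genHermite k * X ^ n) =
          shiftCoeff k * (Nat.factorial k : ℝ) * a k := by
        rw [hX, mul_add, map_add, backMoment_genHermite_mul_genHermite_of_ne k.isLt.ne, zero_add,
          Finset.mul_sum, map_sum, Finset.sum_eq_single (k : ℕ)]
        · rw [mul_left_comm, ← smul_eq_C_mul, map_smul, backMoment_genHermite_mul_self,
            smul_eq_mul]
          have : ((-1 : ℝ) ^ (k : ℕ)) * (-1) ^ (k : ℕ) = 1 := by rw [← mul_pow]; norm_num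
          linear_combination (a k * (shiftCoeff k * (Nat.factorial k : ℝ))) * this
        · intro j _ hj
          rw [mul_left_comm, ← smul_eq_C_mul, map_smul,
            backMoment_genHermite_mul_genHermite_of_ne hj.symm, smul_zero]
        · intro h; exact absurd (Finset.mem_range.2 k.isLt) h
      rw [ih k k.isLt, scalarProd_genHermite_self, hpow, scalarProd_genHermite, hm, ← coe_inv,
        ← Quaternion.coe_mul, inv_mul_cancel_left₀ hk]
    funext z
    rw [orthoPoly]
    simp only [hcoef]
    have hz := congrArg (aeval (toQuat z)) hX
    simp only [map_pow, aeval_X, map_add, map_sum, map_mul, aeval_C] at hz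
    rw [hz, ← Fin.sum_univ_eq_sum_range (fun k => algebraMap ℝ ℍ[ℝ] (a k) *
      aeval (toQuat z) (genHermite k)), add_sub_assoc, add_eq_left, sub_eq_zero]
    refine Finset.sum_congr rfl fun k _ => ?_
    rw [ih k k.isLt]
    exact Algebra.commutes _ _

theorem sqNorm_eq (k : ℕ) : sqNorm k = shiftCoeff k * k.factorial := by
  unfold sqNorm
  rw [orthoPoly_eq, scalarProd_genHermite_self, re_coe]

end

/-! ### The kernel along rays and its reduction to the classical Hermite kernel -/

noncomputable section

open Polynomial

/-- The monic (probabilists') Hermite polynomials as real functions. -/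
def herm : ℕ → ℝ → ℝ
  | 0, _ => 1
  | 1, x => x
  | n + 2, x => x * herm (n + 1) x - ((n : ℝ) + 1) * herm n x

theorem herm_add_two (n : ℕ) (x : ℝ) :
    herm (n + 2) x = x * herm (n + 1) x - ((n : ℝ) + 1) * herm n x := by
  rw [herm]

theorem herm_neg (n : ℕ) (x : ℝ) : herm n (-x) = (-1) ^ n * herm n x := by
  induction n using Nat.strong_induction_on with
  | _ n ih =>
    match n with
    | 0 => simp [herm]
    | 1 => simp [herm]
    | n + 2 =>
      rw [herm_add_two, herm_add_two, ih (n + 1) (by omega), ih n (by omega)]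
      ring

theorem hasDerivAt_herm (n : ℕ) (x : ℝ) :
    HasDerivAt (herm n) (x * herm n x - herm (n + 1) x) x := by
  induction n using Nat.strong_induction_on with
  | _ n ih =>
    match n with
    | 0 => simpa [herm] using hasDerivAt_const x (1 : ℝ)
    | 1 =>
      refine (hasDerivAt_id x).congr_deriv ?_
      simp [herm]
    | n + 2 =>
      have h := ((hasDerivAt_id x).mul (ih (n + 1) (by omega))).sub
        ((ih n (by omega)).const_mul ((n : ℝ) + 1))
      refine (h.congr_deriv ?_).congr_of_eventuallyEq
        (Filter.Eventually.of_forall fun y => herm_add_two n y)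
      rw [herm_add_two (n + 1), herm_add_two n]
      simp only [id]
      push_cast
      ring

theorem aeval_smul_imagHermite {q : ℍ[ℝ]} (hq : q ^ 2 = -1) (s : ℝ) (n : ℕ) :
    aeval (s • q) (imagHermite n) = herm n s • q ^ n := by
  induction n using Nat.strong_induction_on with
  | _ n ih =>
    match n with
    | 0 => simp [imagHermite, herm]
    | 1 => simp [imagHermite, herm]
    | n + 2 =>
      have h : q ^ n = -q ^ (n + 2) := by rw [pow_add, hq]; simp
      rw [imagHermite_add_two, ← smul_eq_C_mul]
      simp only [map_add, map_mul, map_smul, aeval_X]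
      rw [ih (n + 1) (by omega), ih n (by omega), smul_mul_smul_comm, ← pow_succ', h,
        herm_add_two]
      module

/-- The monic generalized Hermite polynomials for the weight `x² exp (-x² / 2)`, away from `0`. -/
def genHerm (n : ℕ) (x : ℝ) : ℝ := (herm (n + 2) x + shiftCoeff n * herm n x) / x ^ 2

theorem aeval_smul_genHermite {q : ℍ[ℝ]} (hq : q ^ 2 = -1) {s : ℝ} (hs : s ≠ 0) (n : ℕ) :
    aeval (s • q) (genHermite n) = genHerm n s • q ^ n := by
  have h := congrArg (aeval (s • q)) (X_sq_mul_genHermite n)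
  rw [← smul_eq_C_mul] at h
  simp only [map_sub, map_mul, map_smul, map_pow, aeval_X, aeval_smul_imagHermite hq, _root_.smul_pow,
    hq, pow_add] at h
  have h' : s ^ 2 • aeval (s • q) (genHermite n) =
      (herm (n + 2) s + shiftCoeff n * herm n s) • q ^ n := by
    simp only [smul_mul_assoc, neg_mul, one_mul, mul_neg, mul_one, smul_neg] at h
    rw [← neg_inj, h]
    module
  rw [genHerm, div_eq_inv_mul, ← smul_smul, ← h', smul_smul, inv_mul_cancel₀ (by positivity),
    one_smul]

theorem orthoPoly_smul {u : Space} (hu : ‖u‖ = 1) {s : ℝ} (hs : s ≠ 0) (n : ℕ) :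
    orthoPoly n (s • u) = genHerm n s • toQuat u ^ n := by
  rw [orthoPoly_eq]
  dsimp only
  rw [toQuat_smul]
  exact aeval_smul_genHermite (by rw [toQuat_sq, hu]; simp) hs n

/-- The terms of even degree in the kernel, along rays. -/
def evenKernel (n : ℕ) (s t : ℝ) : ℝ :=
  ∑ k ∈ Finset.range (n + 1),
    if Even k then genHerm k s * genHerm k t / (shiftCoeff k * k.factorial) else 0

/-- The terms of odd degree in the kernel, along rays. -/
def oddKernel (n : ℕ) (s t : ℝ) : ℝ :=
  ∑ k ∈ Finset.range (n + 1),
    if Even k then 0 else genHerm k s * genHerm k t / (shiftCoeff k * k.factorial)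

/-- Since the squares of `u` and `v` are both `-1`, the factor of `u ^ k` times the conjugate of `v
^ k` depends only on the parity of `k`. It is `1` for even `k` and `-uv` for odd `k`. -/
theorem kernel_smul_smul {u v : Space} (hu : ‖u‖ = 1) (hv : ‖v‖ = 1) {s t : ℝ} (hs : s ≠ 0)
    (ht : t ≠ 0) (n : ℕ) :
    kernel n (s • u) (t • v) =
      evenKernel n s t • (1 : ℍ[ℝ]) - oddKernel n s t • (toQuat u * toQuat v) := by
  rw [kernel, evenKernel, oddKernel, Finset.sum_smul, Finset.sum_smul, ← Finset.sum_sub_distrib]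
  refine Finset.sum_congr rfl fun k _ => ?_
  have hu2 : toQuat u ^ 2 = -1 := by rw [toQuat_sq, hu]; simp
  have hv2 : toQuat v ^ 2 = -1 := by rw [toQuat_sq, hv]; simp
  have hmul : ((-1 : ℍ[ℝ]) ^ (k / 2)) * (-1) ^ (k / 2) = 1 := by
    rw [← pow_add, ← two_mul, pow_mul]; simp
  rw [orthoPoly_smul hu hs, orthoPoly_smul hv ht, Quaternion.star_smul, star_pow, star_toQuat,
    smul_mul_smul_comm, smul_smul, sqNorm_eq, inv_mul_eq_div]
  by_cases h : Even k
  · obtain ⟨j, rfl⟩ := h.two_dvd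
    rw [Nat.mul_div_cancel_left _ two_pos] at hmul
    rw [if_pos h, if_pos h, pow_mul, pow_mul, neg_sq, hu2, hv2, hmul, zero_smul, sub_zero]
  · obtain ⟨j, rfl⟩ := Nat.not_even_iff_odd.1 h
    rw [show (2 * j + 1) / 2 = j by omega] at hmul
    rw [if_neg h, if_neg h, pow_succ, pow_succ, pow_mul, pow_mul, neg_sq, hu2, hv2, zero_smul,
      zero_sub, ← smul_neg]
    congr 1
    have hc : toQuat u * (-1) ^ j = (-1) ^ j * toQuat u :=
      ((Commute.neg_one_right (toQuat u)).pow_right j).eq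
    calc (-1) ^ j * toQuat u * ((-1) ^ j * -toQuat v)
        = (-1) ^ j * (toQuat u * (-1) ^ j) * -toQuat v := by noncomm_ring
      _ = ((-1) ^ j * (-1) ^ j) * (toQuat u * -toQuat v) := by rw [hc]; noncomm_ring
      _ = -(toQuat u * toQuat v) := by rw [hmul, one_mul, mul_neg]

/-- The Hermite kernel, a sum over degrees at most `N`. -/
def hermKernel (N : ℕ) (s t : ℝ) : ℝ :=
  ∑ j ∈ Finset.range (N + 1), herm j s * herm j t / j.factorial

/-- The Christoffel-Darboux formula, which telescopes by the three-term recurrence. -/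
theorem sub_mul_hermKernel (N : ℕ) (s t : ℝ) :
    (s - t) * hermKernel N s t =
      (herm (N + 1) s * herm N t - herm N s * herm (N + 1) t) / N.factorial := by
  induction N with
  | zero => simp [hermKernel, herm]
  | succ N ih =>
    rw [hermKernel, Finset.sum_range_succ, ← hermKernel, mul_add, ih, herm_add_two, herm_add_two,
      Nat.factorial_succ]
    have : (N.factorial : ℝ) ≠ 0 := by positivity
    have : (N : ℝ) + 1 ≠ 0 := by positivity
    push_cast
    field_simp
    ring

theorem sum_odd_eq (N : ℕ) (s t : ℝ) :
    (∑ j ∈ Finset.range (N + 1), if Even j then 0 else herm j s * herm j t / j.factorial) =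
      (hermKernel N s t - hermKernel N s (-t)) / 2 := by
  rw [hermKernel, hermKernel, ← Finset.sum_sub_distrib, Finset.sum_div]
  refine Finset.sum_congr rfl fun j _ => ?_
  rw [herm_neg]
  split_ifs with h
  · rw [h.neg_one_pow]; ring
  · rw [(Nat.not_even_iff_odd.1 h).neg_one_pow]; ring

theorem sum_even_eq (N : ℕ) (s t : ℝ) :
    (∑ j ∈ Finset.range (N + 1), if Even j then herm j s * herm j t / j.factorial else 0) =
      (hermKernel N s t + hermKernel N s (-t)) / 2 := by
  rw [hermKernel, hermKernel, ← Finset.sum_add_distrib, Finset.sum_div]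
  refine Finset.sum_congr rfl fun j _ => ?_
  rw [herm_neg]
  split_ifs with h
  · rw [h.neg_one_pow]; ring
  · rw [(Nat.not_even_iff_odd.1 h).neg_one_pow]; ring

theorem mul_evenKernel (n : ℕ) {s t : ℝ} (hs : s ≠ 0) (ht : t ≠ 0) :
    s * t * evenKernel n s t = (hermKernel (n + 1) s t - hermKernel (n + 1) s (-t)) / 2 := by
  rw [← sum_odd_eq]
  -- In even degree `shiftCoeff k = k + 1` cancels the lower term of the Hermite recurrence, leaving
  -- a single Hermite polynomial over `x`.
  have hp : ∀ (k : ℕ) {x : ℝ}, Even k → x ≠ 0 → genHerm k x = herm (k + 1) x / x := by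
    intro k x hk hx
    rw [genHerm, herm_add_two, shiftCoeff, if_pos hk]
    field_simp
    ring
  induction n with
  | zero => simp [evenKernel, hp 0 Even.zero hs, hp 0 Even.zero ht, Finset.sum_range_succ, herm,
      shiftCoeff, hs, ht]
  | succ n ih =>
    rw [evenKernel, Finset.sum_range_succ, ← evenKernel, mul_add, ih,
      Finset.sum_range_succ _ (n + 1 + 1)]
    congr 1
    by_cases h : Even (n + 1)
    · rw [if_pos h, if_neg (by simpa [parity_simps] using h), hp _ h hs, hp _ h ht, shiftCoeff,
        if_pos h, Nat.factorial_succ (n + 1)]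
      have : ((n + 1).factorial : ℝ) ≠ 0 := by positivity
      have : (n : ℝ) + 1 + 1 ≠ 0 := by positivity
      push_cast
      field_simp
    · rw [if_neg h, if_pos (by simpa [parity_simps] using h), mul_zero]

/-- The degree of the rank-one correction in the odd part of the kernel. -/
def remDegree (n : ℕ) : ℕ := if Even n then n + 1 else n + 2

/-- In odd degree no such collapse occurs, because the weight forces a double zero to be divided
out. The sum telescopes against the even Hermite terms except for one product of odd degree
`remDegree n`. -/
theorem mul_oddKernel (n : ℕ) {s t : ℝ} (hs : s ≠ 0) (ht : t ≠ 0) :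
    s * t * oddKernel n s t = (hermKernel (n + 1) s t + hermKernel (n + 1) s (-t)) / 2 -
      herm (remDegree n) s * herm (remDegree n) t / (s * t * (remDegree n).factorial) := by
  rw [← sum_even_eq]
  induction n with
  | zero => simp [oddKernel, Finset.sum_range_succ, herm, remDegree, hs, ht]
  | succ n ih =>
    rw [oddKernel, Finset.sum_range_succ, ← oddKernel, mul_add, ih,
      Finset.sum_range_succ _ (n + 1 + 1)]
    by_cases h : Even (n + 1)
    · have h' : ¬ Even n := by simpa [parity_simps] using h
      have h2 : ¬ Even (n + 1 + 1) := by simpa [parity_simps] using h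
      rw [if_pos h, if_neg h2, remDegree, remDegree, if_pos h, if_neg h']
      ring
    -- Here a new odd term enters, and the remainder degree jumps from `n + 1` to `n + 3`.
    · have h' : Even n := by simpa [parity_simps] using h
      have h2 : Even (n + 1 + 1) := by simpa [parity_simps] using h
      rw [if_neg h, if_pos h2, remDegree, remDegree, if_neg h, if_pos h', genHerm, genHerm,
        shiftCoeff, if_neg h, show n + 1 + 2 = n + 2 + 1 by ring, Nat.factorial_succ (n + 2),
        show n + 1 + 1 = n + 2 by ring, Nat.factorial_succ (n + 1)]
      have e1 : ∀ x, herm (n + 2 + 1) x = x * herm (n + 2) x - ((n : ℝ) + 2) * herm (n + 1) x := by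
        intro x
        rw [show n + 2 + 1 = n + 1 + 2 by ring, herm_add_two]
        push_cast
        ring
      rw [e1 s, e1 t]
      have : ((n + 1).factorial : ℝ) ≠ 0 := by positivity
      have : (n : ℝ) + 1 + 1 ≠ 0 := by positivity
      have : (n : ℝ) + 2 + 1 ≠ 0 := by positivity
      have : (n : ℝ) + 1 + 2 ≠ 0 := by positivity
      push_cast
      generalize herm (n + 2) s = A
      generalize herm (n + 2) t = B
      generalize herm (n + 1) s = A'
      generalize herm (n + 1) t = B'
      field_simp
      ring

end

/-! ### Adiabatic invariants of `f'' = -(l - x² / 4) f` -/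

noncomputable section

/-- The local frequency of the oscillator equation `f'' = -(l - x² / 4) f`. -/
def freq (l x : ℝ) : ℝ := √(l - x ^ 2 / 4)

/-- The leading adiabatic invariant of the pair `(f, f') = (f, g)`. -/
def action (l : ℝ) (f g : ℝ → ℝ) (x : ℝ) : ℝ := freq l x * f x ^ 2 + g x ^ 2 / freq l x

theorem freq_sq {l x : ℝ} (h : x ^ 2 / 4 ≤ l) : freq l x ^ 2 = l - x ^ 2 / 4 :=
  Real.sq_sqrt (by linarith)

theorem mul_sqrt_le_freq {r l x : ℝ} (hl : 0 < l)
    (hx : x ^ 2 ≤ 4 * (1 - r ^ 2) * l) : r * √l ≤ freq l x := by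
  refine Real.le_sqrt_of_sq_le ?_
  rw [mul_pow, Real.sq_sqrt hl.le]
  linarith

theorem freq_le_sqrt (l x : ℝ) : freq l x ≤ √l :=
  Real.sqrt_le_sqrt (by linarith [sq_nonneg x])

theorem two_mul_abs_le_action {l x : ℝ} (f g : ℝ → ℝ) (hw : 0 < freq l x) :
    2 * |f x * g x| ≤ action l f g x := by
  have key : ∀ e : ℝ, e ^ 2 = 1 → 0 ≤ action l f g x - 2 * e * (f x * g x) := by
    intro e he
    have : action l f g x - 2 * e * (f x * g x) =
        (freq l x * f x - e * g x) ^ 2 / freq l x := by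
      rw [action]
      field_simp
      linear_combination (-g x ^ 2) * he
    rw [this]; positivity
  rcases abs_cases (f x * g x) with ⟨h, _⟩ | ⟨h, _⟩
  · linarith [key 1 (by norm_num)]
  · linarith [key (-1) (by norm_num)]

theorem action_nonneg {l x : ℝ} (f g : ℝ → ℝ) : 0 ≤ action l f g x := by
  unfold action freq; positivity

theorem hasDerivAt_freq {l x : ℝ} (hw : 0 < freq l x) :
    HasDerivAt (freq l) (-x / (4 * freq l x)) x := by
  have h := (((hasDerivAt_pow 2 x).div_const 4).const_sub l).sqrt (by
    intro h0
    rw [freq, h0, Real.sqrt_zero] at hw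
    exact lt_irrefl _ hw)
  refine h.congr_deriv ?_
  change _ / (2 * freq l x) = _
  field_simp
  norm_num

/-- The first-order corrected adiabatic invariant. -/
def corrAction (l : ℝ) (f g : ℝ → ℝ) (x : ℝ) : ℝ :=
  action l f g x - x / (4 * freq l x ^ 3) * (f x * g x)

/-- The correction is chosen so that the derivative of `x / (4 w³)` times `f g`, taken on the factor
`f g`, cancels the derivative of the action. What remains differentiates only the slowly varying
coefficient. -/
theorem hasDerivAt_corrAction {l x : ℝ} {f g : ℝ → ℝ} (hw : 0 < freq l x)
    (hf : HasDerivAt f (g x) x) (hg : HasDerivAt g (-(l - x ^ 2 / 4) * f x) x) :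
    HasDerivAt (corrAction l f g)
      ((-1 / (4 * freq l x ^ 3) - 3 * x ^ 2 / (16 * freq l x ^ 5)) * (f x * g x)) x := by
  have hF := hasDerivAt_freq hw
  have h := ((hF.mul (hf.pow 2)).add ((hg.pow 2).div hF hw.ne')).sub
    (((hasDerivAt_id x).div ((hF.pow 3).const_mul 4) (by simp; positivity)).mul (hf.mul hg))
  -- Beyond the turning point the real square root is `0`, so a positive frequency forces `x² / 4 ≤
  -- l`.
  have hsq : l - x ^ 2 / 4 = freq l x ^ 2 := (freq_sq (by
    by_contra hc
    rw [freq, Real.sqrt_eq_zero_of_nonpos (by linarith)] at hw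
    exact lt_irrefl _ hw)).symm
  refine h.congr_deriv ?_
  rw [hsq]
  simp only [id, Pi.pow_apply, Pi.mul_apply, Pi.div_apply]
  field_simp
  ring

/-- In the bulk `w ≥ r √l` and `x ≤ 2 √l`, so the logarithmic derivative of the corrected action is
`O(l^(-3/2))`. Integrating over a length `O(√l)` gives `O(1 / l)`, and the correction itself has
relative size `O(1 / l)`. -/
theorem action_bounds {r l X : ℝ} {f g : ℝ → ℝ} (hr : 0 < r) (hl : 0 < l) (hX : 0 ≤ X)
    (hXl : X ^ 2 ≤ 4 * (1 - r ^ 2) * l) (hf : ∀ x, HasDerivAt f (g x) x)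
    (hg : ∀ x, HasDerivAt g (-(l - x ^ 2 / 4) * f x) x) (hb : 1 / (4 * r ^ 3 * l) ≤ 1 / 2) :
    action l f g 0 * Real.exp (-((1 / (2 * r ^ 3) + 3 / (2 * r ^ 5)) / l)) ≤
        action l f g X * (1 + 1 / (4 * r ^ 3 * l)) ∧
      action l f g X * (1 - 1 / (4 * r ^ 3 * l)) ≤
        action l f g 0 * Real.exp ((1 / (2 * r ^ 3) + 3 / (2 * r ^ 5)) / l) := by
  set L := √l with hL
  have hLpos : 0 < L := Real.sqrt_pos.2 hl
  have hLsq : L ^ 2 = l := Real.sq_sqrt hl.le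
  have hr1 : r ^ 2 ≤ 1 := by
    by_contra hc
    have : 4 * (1 - r ^ 2) * l < 0 := mul_neg_of_neg_of_pos (by linarith) hl
    linarith [sq_nonneg X]
  -- The coefficient in the derivative of the corrected action, bounded using `w ≥ r L` and `x² ≤ 4
  -- L²`.
  set κ : ℝ := 1 / (4 * (r * L) ^ 3) + 3 * (4 * L ^ 2) / (16 * (r * L) ^ 5) with hκ
  have hκ0 : 0 ≤ κ := by positivity
  have hκX : κ * X ≤ (1 / (2 * r ^ 3) + 3 / (2 * r ^ 5)) / l := by
    have hX2 : X ≤ 2 * L := by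
      refine abs_le_of_sq_le_sq' ?_ (by positivity) |>.2
      rw [mul_pow, hLsq]
      nlinarith [mul_nonneg (sq_nonneg r) hl.le]
    calc κ * X ≤ κ * (2 * L) := by gcongr
      _ = (1 / (2 * r ^ 3) + 3 / (2 * r ^ 5)) / l := by
        rw [hκ, ← hLsq]; field_simp; ring
  have hin : ∀ x ∈ Set.Icc 0 X, x ^ 2 ≤ 4 * (1 - r ^ 2) * l := fun x hx =>
    (pow_le_pow_left₀ hx.1 hx.2 2).trans hXl
  have hw : ∀ x ∈ Set.Icc 0 X, r * L ≤ freq l x := fun x hx =>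
    mul_sqrt_le_freq hl (hin x hx)
  have hwpos : ∀ x ∈ Set.Icc 0 X, 0 < freq l x := fun x hx =>
    lt_of_lt_of_le (by positivity) (hw x hx)
  have hclose : ∀ x ∈ Set.Icc 0 X, |corrAction l f g x - action l f g x| ≤
      1 / (4 * r ^ 3 * l) * action l f g x := by
    intro x hx
    have hx2 : x ≤ 2 * L := by
      refine abs_le_of_sq_le_sq' ?_ (by positivity) |>.2
      rw [mul_pow, hLsq]
      nlinarith [hin x hx, mul_nonneg (sq_nonneg r) hl.le]
    have h1 : x / (4 * freq l x ^ 3) ≤ 2 * L / (4 * (r * L) ^ 3) := by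
      gcongr
      exact hw x hx
    have h2 : 2 * L / (4 * (r * L) ^ 3) = 2 * (1 / (4 * r ^ 3 * l)) := by
      rw [← hLsq]; field_simp
    have h3 := two_mul_abs_le_action f g (hwpos x hx)
    have h4 : 0 ≤ x / (4 * freq l x ^ 3) := div_nonneg hx.1 (by have := hwpos x hx; positivity)
    rw [corrAction, sub_sub_cancel_left, abs_neg, abs_mul, abs_of_nonneg h4]
    calc x / (4 * freq l x ^ 3) * |f x * g x|
        ≤ 2 * (1 / (4 * r ^ 3 * l)) * |f x * g x| := by
          rw [← h2]; gcongr
      _ = 1 / (4 * r ^ 3 * l) * (2 * |f x * g x|) := by ring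
      _ ≤ _ := by gcongr
  -- This is where `hb` enters. Together with `2 |f g| ≤ action` it bounds `|f g|` by the corrected
  -- action, which closes the Grönwall inequality.
  have hhalf : ∀ x ∈ Set.Icc 0 X, action l f g x ≤ 2 * corrAction l f g x := by
    intro x hx
    have h1 := (abs_le.1 (hclose x hx)).1
    have h2 : 1 / (4 * r ^ 3 * l) * action l f g x ≤ 1 / 2 * action l f g x := by
      gcongr
      exact action_nonneg f g
    linarith
  have hder : ∀ x ∈ Set.Icc 0 X,
      |(-1 / (4 * freq l x ^ 3) - 3 * x ^ 2 / (16 * freq l x ^ 5)) * (f x * g x)| ≤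
        κ * corrAction l f g x := by
    intro x hx
    have hwx := hwpos x hx
    have hx2 : x ^ 2 ≤ 4 * L ^ 2 := by
      rw [hLsq]; nlinarith [hin x hx, mul_nonneg (sq_nonneg r) hl.le]
    have h1 : |-1 / (4 * freq l x ^ 3) - 3 * x ^ 2 / (16 * freq l x ^ 5)| ≤ κ := by
      rw [show -1 / (4 * freq l x ^ 3) - 3 * x ^ 2 / (16 * freq l x ^ 5) =
        -(1 / (4 * freq l x ^ 3) + 3 * x ^ 2 / (16 * freq l x ^ 5)) by ring, abs_neg,
        abs_of_nonneg (by positivity), hκ]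
      have := hw x hx
      gcongr
    rw [abs_mul]
    have h3 := two_mul_abs_le_action f g hwx
    calc _ ≤ κ * |f x * g x| := by gcongr
      _ ≤ κ * corrAction l f g x := by
        gcongr
        linarith [hhalf x hx]
  have hD : ∀ x ∈ Set.Icc 0 X, HasDerivAt (corrAction l f g) _ x := fun x hx =>
    hasDerivAt_corrAction (hwpos x hx) (hf x) (hg x)
  have hmul : ∀ e : ℝ, ∀ x ∈ Set.Icc 0 X,
      HasDerivAt (fun x => corrAction l f g x * Real.exp (e * x))
        (((-1 / (4 * freq l x ^ 3) - 3 * x ^ 2 / (16 * freq l x ^ 5)) * (f x * g x) +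
          e * corrAction l f g x) * Real.exp (e * x)) x := by
    intro e x hx
    refine ((hD x hx).mul ((hasDerivAt_id x).const_mul e).exp).congr_deriv ?_
    simp only [id]
    ring
  have h0 : (0 : ℝ) ∈ Set.Icc 0 X := ⟨le_rfl, hX⟩
  have hXm : X ∈ Set.Icc 0 X := ⟨hX, le_rfl⟩
  have hzero : corrAction l f g 0 = action l f g 0 := by simp [corrAction]
  have hup : corrAction l f g X * Real.exp (-κ * X) ≤ action l f g 0 := by
    have hanti : AntitoneOn (fun x => corrAction l f g x * Real.exp (-κ * x)) (Set.Icc 0 X) := by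
      refine antitoneOn_of_hasDerivWithinAt_nonpos (convex_Icc _ _)
        (fun x hx => (hmul (-κ) x hx).continuousAt.continuousWithinAt)
        (fun x hx => (hmul (-κ) x (interior_subset hx)).hasDerivWithinAt) fun x hx => ?_
      refine mul_nonpos_of_nonpos_of_nonneg ?_ (Real.exp_pos _).le
      linarith [(abs_le.1 (hder x (interior_subset hx))).2]
    simpa [hzero] using hanti h0 hXm hX
  have hlo : action l f g 0 ≤ corrAction l f g X * Real.exp (κ * X) := by
    have hmono : MonotoneOn (fun x => corrAction l f g x * Real.exp (κ * x)) (Set.Icc 0 X) := by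
      refine monotoneOn_of_hasDerivWithinAt_nonneg (convex_Icc _ _)
        (fun x hx => (hmul κ x hx).continuousAt.continuousWithinAt)
        (fun x hx => (hmul κ x (interior_subset hx)).hasDerivWithinAt) fun x hx => ?_
      refine mul_nonneg ?_ (Real.exp_pos _).le
      linarith [(abs_le.1 (hder x (interior_subset hx))).1]
    simpa [hzero] using hmono h0 hXm hX
  obtain ⟨hc1, hc2⟩ := abs_le.1 (hclose X hXm)
  have hA0 : 0 ≤ action l f g 0 := action_nonneg f g
  constructor
  · calc action l f g 0 * Real.exp (-((1 / (2 * r ^ 3) + 3 / (2 * r ^ 5)) / l))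
        ≤ action l f g 0 * Real.exp (-(κ * X)) := by gcongr
      _ ≤ corrAction l f g X * Real.exp (κ * X) * Real.exp (-(κ * X)) := by gcongr
      _ = corrAction l f g X := by rw [mul_assoc, ← Real.exp_add]; simp
      _ ≤ _ := by linarith
  · calc action l f g X * (1 - 1 / (4 * r ^ 3 * l)) ≤ corrAction l f g X := by linarith
      _ = corrAction l f g X * Real.exp (-κ * X) * Real.exp (κ * X) := by
        rw [mul_assoc, ← Real.exp_add]; simp
      _ ≤ action l f g 0 * Real.exp (κ * X) := by gcongr
      _ ≤ _ := by gcongr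

/-- The bracket that appears in the Christoffel-Darboux formula, locally. -/
theorem abs_bracket_sub_le {l r B s t : ℝ} {f g : ℝ → ℝ} (hr : 0 < r) (hl : 0 < l)
    (hs : 0 ≤ s) (ht : 0 ≤ t) (hsl : s ^ 2 ≤ 4 * (1 - r ^ 2) * l)
    (htl : t ^ 2 ≤ 4 * (1 - r ^ 2) * l)
    (hf : ∀ x, HasDerivAt f (g x) x) (hg : ∀ x, HasDerivAt g (-(l - x ^ 2 / 4) * f x) x)
    (hB : ∀ x, 0 ≤ x → x ^ 2 ≤ 4 * (1 - r ^ 2) * l → action l f g x ≤ B) :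
    |f s * g t - g s * f t - action l f g t * Real.sin (freq l t * (s - t))| ≤
      2 * B / r * |s - t| ^ 2 := by
  set L := √l with hL
  have hLpos : 0 < L := Real.sqrt_pos.2 hl
  have hLsq : L ^ 2 = l := Real.sq_sqrt hl.le
  set w := freq l t with hw
  have hwL : r * L ≤ w := mul_sqrt_le_freq hl htl
  have hwpos : 0 < w := lt_of_lt_of_le (by positivity) hwL
  have hwsq : w ^ 2 = l - t ^ 2 / 4 := freq_sq (by nlinarith [mul_nonneg (sq_nonneg r) hl.le])
  -- Propagates the solution from `x` to `s` with the frequency frozen at its value at `t`. `F`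
  -- would be constant if the frequency were; `F s` is the bracket and `F t` its sine approximation,
  -- so only the frequency drift contributes.
  set F : ℝ → ℝ := fun x => Real.cos (w * (s - x)) * (f x * g t - g x * f t) +
    Real.sin (w * (s - x)) / w * (g x * g t + w ^ 2 * (f x * f t)) with hF
  have hFd : ∀ x, HasDerivAt F ((l - x ^ 2 / 4 - w ^ 2) * f x *
      (Real.cos (w * (s - x)) * f t - Real.sin (w * (s - x)) / w * g t)) x := by
    intro x
    have hlin : HasDerivAt (fun x => w * (s - x)) (w * -1) x :=
      ((hasDerivAt_id x).const_sub s).const_mul w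
    have h := (hlin.cos.mul (((hf x).mul_const (g t)).sub ((hg x).mul_const (f t)))).add
      ((hlin.sin.div_const w).mul (((hg x).mul_const (g t)).add
        (((hf x).mul_const (f t)).const_mul (w ^ 2))))
    refine h.congr_deriv ?_
    simp only [Pi.sub_apply, Pi.add_apply]
    field_simp
    ring
  have hfb : ∀ x, 0 ≤ x → x ^ 2 ≤ 4 * (1 - r ^ 2) * l → f x ^ 2 ≤ B / (r * L) := by
    intro x hx0 hx
    have h1 := mul_sqrt_le_freq hl hx
    have hp : 0 < r * L := by positivity
    rw [le_div_iff₀ hp]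
    calc f x ^ 2 * (r * L) ≤ freq l x * f x ^ 2 := by rw [mul_comm]; gcongr
      _ ≤ action l f g x := by
        rw [action]; have : 0 < freq l x := hp.trans_le h1
        linarith [div_nonneg (sq_nonneg (g x)) this.le]
      _ ≤ B := hB x hx0 hx
  have hgb : (g t / w) ^ 2 ≤ B / (r * L) := by
    have hp : 0 < r * L := by positivity
    rw [le_div_iff₀ hp]
    calc (g t / w) ^ 2 * (r * L) ≤ (g t / w) ^ 2 * w := by gcongr
      _ = g t ^ 2 / w := by field_simp
      _ ≤ action l f g t := by
        rw [action, ← hw]; linarith [mul_nonneg hwpos.le (sq_nonneg (f t))]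
      _ ≤ B := hB t ht htl
  have hB0 : 0 ≤ B := (action_nonneg f g).trans (hB t ht htl)
  have hbound : ∀ x ∈ Set.uIcc t s, ‖(l - x ^ 2 / 4 - w ^ 2) * f x *
      (Real.cos (w * (s - x)) * f t - Real.sin (w * (s - x)) / w * g t)‖ ≤
        2 * B / r * |s - t| := by
    intro x hx
    have hx0 : 0 ≤ x := (le_min ht hs).trans hx.1
    have hxl : x ^ 2 ≤ 4 * (1 - r ^ 2) * l := by
      rcases le_max_iff.1 hx.2 with h | h
      · exact (pow_le_pow_left₀ hx0 h 2).trans htl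
      · exact (pow_le_pow_left₀ hx0 h 2).trans hsl
    have hub : ∀ y, 0 ≤ y → y ^ 2 ≤ 4 * (1 - r ^ 2) * l → y ≤ 2 * L := by
      intro y hy hyl
      refine abs_le_of_sq_le_sq' ?_ (by positivity) |>.2
      rw [mul_pow, hLsq]
      nlinarith [mul_nonneg (sq_nonneg r) hl.le]
    have hq : |l - x ^ 2 / 4 - w ^ 2| ≤ L * |s - t| := by
      rw [hwsq, show l - x ^ 2 / 4 - (l - t ^ 2 / 4) = -((x + t) / 4 * (x - t)) by ring, abs_neg,
        abs_mul, abs_of_nonneg (by positivity)]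
      have h1 : |x - t| ≤ |s - t| := Set.abs_sub_left_of_mem_uIcc hx
      have h2 : (x + t) / 4 ≤ L := by linarith [hub x hx0 hxl, hub t ht htl]
      gcongr
    have hprod : |f x * (Real.cos (w * (s - x)) * f t - Real.sin (w * (s - x)) / w * g t)| ≤
        2 * (B / (r * L)) := by
      have e1 : |f x * (Real.cos (w * (s - x)) * f t)| ≤ B / (r * L) := by
        rw [abs_mul, abs_mul]
        calc |f x| * (|Real.cos (w * (s - x))| * |f t|) ≤ |f x| * (1 * |f t|) := by
              gcongr; exact Real.abs_cos_le_one _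
          _ ≤ (|f x| ^ 2 + |f t| ^ 2) / 2 := by nlinarith [sq_nonneg (|f x| - |f t|)]
          _ ≤ B / (r * L) := by
            rw [sq_abs, sq_abs]; linarith [hfb x hx0 hxl, hfb t ht htl]
      have e2 : |f x * (Real.sin (w * (s - x)) / w * g t)| ≤ B / (r * L) := by
        rw [show Real.sin (w * (s - x)) / w * g t = Real.sin (w * (s - x)) * (g t / w) by ring,
          abs_mul, abs_mul]
        calc |f x| * (|Real.sin (w * (s - x))| * |g t / w|) ≤ |f x| * (1 * |g t / w|) := by
              gcongr; exact Real.abs_sin_le_one _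
          _ ≤ (|f x| ^ 2 + |g t / w| ^ 2) / 2 := by nlinarith [sq_nonneg (|f x| - |g t / w|)]
          _ ≤ B / (r * L) := by
            rw [sq_abs, sq_abs]; linarith [hfb x hx0 hxl, hgb]
      rw [mul_sub]
      exact (abs_sub _ _).trans (by linarith)
    rw [mul_assoc, Real.norm_eq_abs, abs_mul]
    calc _ ≤ L * |s - t| * (2 * (B / (r * L))) := by gcongr
      _ = 2 * B / r * |s - t| := by field_simp
  have hmv := (convex_uIcc t s).norm_image_sub_le_of_norm_hasDerivWithin_le
    (fun x _ => (hFd x).hasDerivWithinAt) hbound Set.left_mem_uIcc Set.right_mem_uIcc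
  have hFs : F s = f s * g t - g s * f t := by simp [hF]
  have hFt : F t = action l f g t * Real.sin (w * (s - t)) := by
    simp only [hF, action]
    rw [← hw]
    field_simp
    ring
  rw [hFs, hFt, Real.norm_eq_abs, Real.norm_eq_abs] at hmv
  refine hmv.trans (le_of_eq ?_)
  ring

end

/-! ### Hermite functions: kernel estimates and values at the origin -/

noncomputable section

open Filter Topology

/-- The Hermite functions, without normalization. -/
def hermFun (N : ℕ) (x : ℝ) : ℝ := herm N x * Real.exp (-x ^ 2 / 4)

/-- The derivative of the Hermite function. -/
def hermFunDeriv (N : ℕ) (x : ℝ) : ℝ := x / 2 * hermFun N x - hermFun (N + 1) x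

theorem hasDerivAt_hermFun (N : ℕ) (x : ℝ) :
    HasDerivAt (hermFun N) (hermFunDeriv N x) x := by
  have h := (hasDerivAt_herm N x).mul (((hasDerivAt_pow 2 x).neg.div_const 4).exp)
  refine h.congr_deriv ?_
  simp only [hermFunDeriv, hermFun, Pi.neg_apply]
  push_cast
  ring

theorem hasDerivAt_hermFunDeriv (N : ℕ) (x : ℝ) :
    HasDerivAt (hermFunDeriv N) (-((N : ℝ) + 1 / 2 - x ^ 2 / 4) * hermFun N x) x := by
  have h := (((hasDerivAt_id x).div_const 2).mul (hasDerivAt_hermFun N x)).sub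
    (hasDerivAt_hermFun (N + 1) x)
  refine h.congr_deriv ?_
  simp only [hermFunDeriv, hermFun, herm_add_two, id]
  ring

theorem continuous_herm (N : ℕ) : Continuous (herm N) :=
  continuous_iff_continuousAt.2 fun x => (hasDerivAt_herm N x).continuousAt

theorem hermFun_neg (N : ℕ) (x : ℝ) : hermFun N (-x) = (-1) ^ N * hermFun N x := by
  rw [hermFun, hermFun, herm_neg, neg_sq]; ring

theorem hermFunDeriv_neg (N : ℕ) (x : ℝ) :
    hermFunDeriv N (-x) = -(-1) ^ N * hermFunDeriv N x := by
  rw [hermFunDeriv, hermFunDeriv, hermFun_neg, hermFun_neg]; ring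

/-- The Hermite kernel with its weight. -/
def weightedKernel (N : ℕ) (s t : ℝ) : ℝ :=
  hermKernel N s t * Real.exp (-(s ^ 2 + t ^ 2) / 4)

theorem sub_mul_weightedKernel (N : ℕ) (s t : ℝ) :
    (s - t) * (N.factorial * weightedKernel N s t) =
      (s - t) * (hermFun N s * hermFun N t / 2) +
        (hermFun N s * hermFunDeriv N t - hermFunDeriv N s * hermFun N t) := by
  have h := sub_mul_hermKernel N s t
  have hN : (N.factorial : ℝ) ≠ 0 := by positivity
  rw [eq_div_iff hN] at h
  have he : Real.exp (-(s ^ 2 + t ^ 2) / 4) = Real.exp (-s ^ 2 / 4) * Real.exp (-t ^ 2 / 4) := by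
    rw [← Real.exp_add]; ring_nf
  simp only [weightedKernel, hermFunDeriv, hermFun, he]
  linear_combination (Real.exp (-s ^ 2 / 4) * Real.exp (-t ^ 2 / 4)) * h

/-- The confluent form of Christoffel-Darboux: the right side of the off-diagonal formula vanishes
at `s = t`, so division by `s - t` and passage to the limit give its derivative. -/
theorem weightedKernel_self (N : ℕ) (t : ℝ) :
    N.factorial * weightedKernel N t t = hermFun N t ^ 2 / 2 +
      (hermFunDeriv N t ^ 2 + ((N : ℝ) + 1 / 2 - t ^ 2 / 4) * hermFun N t ^ 2) := by
  have hG : HasDerivAt (fun s => (s - t) * (hermFun N s * hermFun N t / 2) +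
        (hermFun N s * hermFunDeriv N t - hermFunDeriv N s * hermFun N t))
      (hermFun N t ^ 2 / 2 +
        (hermFunDeriv N t ^ 2 + ((N : ℝ) + 1 / 2 - t ^ 2 / 4) * hermFun N t ^ 2)) t := by
    have h1 := hasDerivAt_hermFun N t
    have h := (((hasDerivAt_id t).sub_const t).mul
      ((h1.mul_const (hermFun N t)).div_const 2)).add
      ((h1.mul_const (hermFunDeriv N t)).sub
        ((hasDerivAt_hermFunDeriv N t).mul_const (hermFun N t)))
    refine h.congr_deriv ?_
    simp only [id]
    ring
  have hcont : Continuous fun s => (N.factorial : ℝ) * weightedKernel N s t := by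
    unfold weightedKernel hermKernel
    have := continuous_herm
    fun_prop
  refine tendsto_nhds_unique (hcont.continuousAt.tendsto.mono_left nhdsWithin_le_nhds)
    ((hasDerivAt_iff_tendsto_slope.1 hG).congr' ?_)
  filter_upwards [self_mem_nhdsWithin] with s hs
  have hst : s - t ≠ 0 := sub_ne_zero.2 hs
  rw [slope_def_field, ← sub_mul_weightedKernel]
  simp only [sub_self, zero_mul, zero_add, mul_comm (hermFun N t) (hermFunDeriv N t)]
  rw [sub_zero, mul_div_cancel_left₀ _ hst]

theorem sq_le_of_action_le {l r B x : ℝ} {f g : ℝ → ℝ} (hr : 0 < r) (hl : 0 < l)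
    (hx : x ^ 2 ≤ 4 * (1 - r ^ 2) * l) (hB : action l f g x ≤ B) :
    f x ^ 2 ≤ B / (r * √l) ∧ g x ^ 2 ≤ B * √l := by
  have hp : 0 < r * √l := mul_pos hr (Real.sqrt_pos.2 hl)
  have h1 := mul_sqrt_le_freq hl hx
  have hw : 0 < freq l x := hp.trans_le h1
  have hB0 := (action_nonneg f g (l := l) (x := x)).trans hB
  unfold action at hB
  constructor
  · rw [le_div_iff₀ hp]
    calc f x ^ 2 * (r * √l) ≤ freq l x * f x ^ 2 := by rw [mul_comm]; gcongr
      _ ≤ B := by linarith [div_nonneg (sq_nonneg (g x)) hw.le]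
  · have : g x ^ 2 / freq l x ≤ B := by linarith [mul_nonneg hw.le (sq_nonneg (f x))]
    rw [div_le_iff₀ hw] at this
    exact this.trans (by gcongr; exact freq_le_sqrt l x)

theorem abs_mul_le_of_sq_le {a b C : ℝ} (ha : a ^ 2 ≤ C) (hb : b ^ 2 ≤ C) : |a * b| ≤ C := by
  rw [abs_mul]
  nlinarith [sq_nonneg (|a| - |b|), sq_abs a, sq_abs b]

/-- The bracket supplies the sinc term with an error linear in `|s - t|`; the product `f(s) f(t) /
2` supplies the other error. The diagonal is treated separately through `weightedKernel_self`. -/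
theorem abs_weightedKernel_sub_le {N : ℕ} {r B s t : ℝ} (hr : 0 < r) (hs : 0 ≤ s) (ht : 0 ≤ t)
    (hsl : s ^ 2 ≤ 4 * (1 - r ^ 2) * ((N : ℝ) + 1 / 2))
    (htl : t ^ 2 ≤ 4 * (1 - r ^ 2) * ((N : ℝ) + 1 / 2))
    (hB : ∀ x, 0 ≤ x → x ^ 2 ≤ 4 * (1 - r ^ 2) * ((N : ℝ) + 1 / 2) →
      action ((N : ℝ) + 1 / 2) (hermFun N) (hermFunDeriv N) x ≤ B) :
    |N.factorial * weightedKernel N s t -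
        action ((N : ℝ) + 1 / 2) (hermFun N) (hermFunDeriv N) t *
          (freq ((N : ℝ) + 1 / 2) t * Real.sinc (freq ((N : ℝ) + 1 / 2) t * (s - t)))| ≤
      B / (r * √((N : ℝ) + 1 / 2)) + 2 * B / r * |s - t| := by
  have hl : 0 < (N : ℝ) + 1 / 2 := by positivity
  set l := (N : ℝ) + 1 / 2 with hldef
  have hw : 0 < freq l t :=
    lt_of_lt_of_le (mul_pos hr (Real.sqrt_pos.2 hl)) (mul_sqrt_le_freq hl htl)
  have hff := abs_mul_le_of_sq_le (sq_le_of_action_le hr hl hsl (hB s hs hsl)).1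
    (sq_le_of_action_le hr hl htl (hB t ht htl)).1
  have hB0 : 0 ≤ B := (action_nonneg _ _).trans (hB t ht htl)
  have hnn : 0 ≤ B / (r * √l) := by positivity
  rcases eq_or_ne s t with rfl | hst
  · rw [weightedKernel_self, sub_self, mul_zero, Real.sinc_zero, mul_one, abs_zero, mul_zero,
      add_zero, ← hldef]
    have h1 : action l (hermFun N) (hermFunDeriv N) s * freq l s =
        hermFunDeriv N s ^ 2 + (l - s ^ 2 / 4) * hermFun N s ^ 2 := by
      rw [← freq_sq (show s ^ 2 / 4 ≤ l by nlinarith [mul_nonneg (sq_nonneg r) hl.le]), action]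
      field_simp
      ring
    rw [h1, add_sub_cancel_right, pow_two, abs_div, abs_two]
    linarith
  · have hst' : s - t ≠ 0 := sub_ne_zero.2 hst
    have hK := sub_mul_weightedKernel N s t
    have hsinc : freq l t * Real.sinc (freq l t * (s - t)) =
        Real.sin (freq l t * (s - t)) / (s - t) := by
      rw [Real.sinc_of_ne_zero (mul_ne_zero hw.ne' hst')]
      field_simp
    have hb := abs_bracket_sub_le hr hl hs ht hsl htl (hasDerivAt_hermFun N)
      (hasDerivAt_hermFunDeriv N) hB
    have e : N.factorial * weightedKernel N s t -
        action l (hermFun N) (hermFunDeriv N) t * (Real.sin (freq l t * (s - t)) / (s - t)) =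
        hermFun N s * hermFun N t / 2 +
        (hermFun N s * hermFunDeriv N t - hermFunDeriv N s * hermFun N t -
          action l (hermFun N) (hermFunDeriv N) t * Real.sin (freq l t * (s - t))) / (s - t) := by
      field_simp
      linear_combination 2 * hK
    rw [hsinc, e]
    refine (abs_add_le _ _).trans (add_le_add ?_ ?_)
    · rw [abs_div, abs_two]; linarith
    · rw [abs_div, div_le_iff₀ (abs_pos.2 hst')]
      exact hb.trans (le_of_eq (by ring))

/-- For opposite signs the Christoffel-Darboux denominator is `s + t`, so there is no resonance.
Parity brings the numerator back to positive arguments. -/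
theorem abs_weightedKernel_neg_le {N : ℕ} {r B s t : ℝ} (hr : 0 < r) (hr1 : r ≤ 1) (hs : 0 < s)
    (ht : 0 < t) (hsl : s ^ 2 ≤ 4 * (1 - r ^ 2) * ((N : ℝ) + 1 / 2))
    (htl : t ^ 2 ≤ 4 * (1 - r ^ 2) * ((N : ℝ) + 1 / 2))
    (hB : ∀ x, 0 ≤ x → x ^ 2 ≤ 4 * (1 - r ^ 2) * ((N : ℝ) + 1 / 2) →
      action ((N : ℝ) + 1 / 2) (hermFun N) (hermFunDeriv N) x ≤ B) :
    |N.factorial * weightedKernel N s (-t)| ≤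
      B / (r * √((N : ℝ) + 1 / 2)) + 2 * B / (r * (s + t)) := by
  have hl : 0 < (N : ℝ) + 1 / 2 := by positivity
  set l := (N : ℝ) + 1 / 2 with hldef
  have hLpos : 0 < √l := Real.sqrt_pos.2 hl
  obtain ⟨fs, gs⟩ := sq_le_of_action_le hr hl hsl (hB s hs.le hsl)
  obtain ⟨ft, gt⟩ := sq_le_of_action_le hr hl htl (hB t ht.le htl)
  have hB0 : 0 ≤ B := (action_nonneg _ _).trans (hB t ht.le htl)
  have hnn : 0 ≤ B / (r * √l) := by positivity
  -- Rescaling `f` by `√l` puts it on the same scale as its derivative.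
  have hcross : ∀ a b : ℝ, a ^ 2 ≤ B / (r * √l) → b ^ 2 ≤ B * √l → |a * b| ≤ B / r := by
    intro a b ha hb
    have h1 : (√l * a) ^ 2 ≤ B / r * √l := by
      calc (√l * a) ^ 2 = √l ^ 2 * a ^ 2 := by ring
        _ ≤ √l ^ 2 * (B / (r * √l)) := by gcongr
        _ = B / r * √l := by field_simp
    have h2 : b ^ 2 ≤ B / r * √l := hb.trans (by
      gcongr
      exact le_div_self hB0 hr hr1)
    have h3 := abs_mul_le_of_sq_le h1 h2
    rw [mul_assoc, abs_mul, abs_of_pos hLpos, mul_comm] at h3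
    exact le_of_mul_le_mul_right h3 hLpos
  have hst : 0 < s + t := add_pos hs ht
  have hK := sub_mul_weightedKernel N s (-t)
  rw [sub_neg_eq_add, hermFun_neg, hermFunDeriv_neg] at hK
  have e : N.factorial * weightedKernel N s (-t) = (-1) ^ N * (hermFun N s * hermFun N t / 2 -
      (hermFun N s * hermFunDeriv N t + hermFun N t * hermFunDeriv N s) / (s + t)) := by
    have hst' := hst.ne'
    field_simp
    linear_combination 2 * hK
  rw [e, abs_mul, abs_pow, abs_neg, abs_one, one_pow, one_mul]
  refine (abs_sub _ _).trans (add_le_add ?_ ?_)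
  · rw [abs_div, abs_two]; linarith [abs_mul_le_of_sq_le fs ft]
  · rw [abs_div, abs_of_pos hst, div_le_iff₀ hst]
    refine (abs_add_le _ _).trans ((add_le_add (hcross _ _ fs gt) (hcross _ _ ft gs)).trans ?_)
    exact le_of_eq (by field_simp; norm_num)

/-- Since `hermFun (N + 1)` is `x / 2` times `hermFun N` minus its derivative, the action of degree
`N` controls it too. The rank-one correction needs this when its degree is `n + 2`. -/
theorem abs_hermFun_succ_mul_le {N : ℕ} {r B s t : ℝ} (hr : 0 < r) (hr1 : r ≤ 1)
    (hs : 0 ≤ s) (ht : 0 ≤ t)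
    (hsl : s ^ 2 ≤ 4 * (1 - r ^ 2) * ((N : ℝ) + 1 / 2))
    (htl : t ^ 2 ≤ 4 * (1 - r ^ 2) * ((N : ℝ) + 1 / 2))
    (hB : ∀ x, 0 ≤ x → x ^ 2 ≤ 4 * (1 - r ^ 2) * ((N : ℝ) + 1 / 2) →
      action ((N : ℝ) + 1 / 2) (hermFun N) (hermFunDeriv N) x ≤ B) :
    |hermFun (N + 1) s * hermFun (N + 1) t| ≤ 4 * B * √((N : ℝ) + 1 / 2) / r := by
  have hl : 0 < (N : ℝ) + 1 / 2 := by positivity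
  set l := (N : ℝ) + 1 / 2 with hldef
  have hLpos : 0 < √l := Real.sqrt_pos.2 hl
  have key : ∀ x, 0 ≤ x → x ^ 2 ≤ 4 * (1 - r ^ 2) * l →
      hermFun (N + 1) x ^ 2 ≤ 4 * B * √l / r := by
    intro x hx hxl
    obtain ⟨fx, gx⟩ := sq_le_of_action_le hr hl hxl (hB x hx hxl)
    have hB0 : 0 ≤ B := (action_nonneg _ _).trans (hB x hx hxl)
    have e : hermFun (N + 1) x = x / 2 * hermFun N x - hermFunDeriv N x := by
      rw [hermFunDeriv]; ring
    have h1 : (x / 2 * hermFun N x) ^ 2 ≤ B * √l / r := by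
      have hx2 : (x / 2) ^ 2 ≤ √l ^ 2 := by
        rw [Real.sq_sqrt hl.le]; nlinarith [mul_nonneg (sq_nonneg r) hl.le]
      calc (x / 2 * hermFun N x) ^ 2 = (x / 2) ^ 2 * hermFun N x ^ 2 := by ring
        _ ≤ √l ^ 2 * (B / (r * √l)) := by gcongr
        _ = B * √l / r := by field_simp
    have h2 : hermFunDeriv N x ^ 2 ≤ B * √l / r :=
      gx.trans (le_div_self (by positivity) hr hr1)
    rw [e]
    calc _ ≤ 2 * (x / 2 * hermFun N x) ^ 2 + 2 * hermFunDeriv N x ^ 2 := by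
          nlinarith [sq_nonneg (x / 2 * hermFun N x + hermFunDeriv N x)]
      _ ≤ 2 * (B * √l / r) + 2 * (B * √l / r) := by linarith
      _ = 4 * B * √l / r := by ring
  exact abs_mul_le_of_sq_le (key s hs hsl) (key t ht htl)

theorem herm_odd_zero (m : ℕ) : herm (2 * m + 1) 0 = 0 := by
  have h := herm_neg (2 * m + 1) 0
  rw [neg_zero, (odd_two_mul_add_one m).neg_one_pow] at h
  linarith

theorem herm_even_zero_sq (m : ℕ) :
    (herm (2 * m) 0 ^ 2 / (2 * m).factorial) ^ 2 * ((2 * m + 1) * Real.Wallis.W m) = 1 := by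
  induction m with
  | zero => simp [herm, Real.Wallis.W]
  | succ m ih =>
    refine Eq.trans ?_ ih
    rw [show 2 * (m + 1) = 2 * m + 2 by ring, herm_add_two, Real.Wallis.W_succ,
      Nat.factorial_succ, Nat.factorial_succ]
    have : ((2 * m).factorial : ℝ) ≠ 0 := by positivity
    have : 2 * (m : ℝ) + 1 ≠ 0 := by positivity
    have : 2 * (m : ℝ) + 2 ≠ 0 := by positivity
    have : 2 * (m : ℝ) + 3 ≠ 0 := by positivity
    push_cast
    rw [show 2 * (m : ℝ) + 1 + 1 = 2 * m + 2 by ring,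
      show 2 * ((m : ℝ) + 1) + 1 = 2 * m + 3 by ring]
    field_simp
    ring

/-- By parity either the function or its derivative vanishes at `0`, and the survivor is an
even-degree Hermite value, whose normalized square is governed by Wallis' product. -/
theorem action_zero_sq (N : ℕ) :
    (action ((N : ℝ) + 1 / 2) (hermFun N) (hermFunDeriv N) 0 / N.factorial) ^ 2 *
      Real.Wallis.W (N / 2) =
        if Even N then ((N : ℝ) + 1 / 2) / (N + 1) else N / ((N : ℝ) + 1 / 2) := by
  have hl : 0 < (N : ℝ) + 1 / 2 := by positivity
  have hL : √((N : ℝ) + 1 / 2) ^ 2 = (N : ℝ) + 1 / 2 := Real.sq_sqrt hl.le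
  have hLpos : 0 < √((N : ℝ) + 1 / 2) := Real.sqrt_pos.2 hl
  have hfreq : freq ((N : ℝ) + 1 / 2) 0 = √((N : ℝ) + 1 / 2) := by simp [freq]
  have hf : hermFun N 0 = herm N 0 := by simp [hermFun]
  have hg : hermFunDeriv N 0 = -herm (N + 1) 0 := by simp [hermFunDeriv, hermFun]
  rw [action, hfreq, hf, hg]
  split_ifs with h
  · obtain ⟨m, rfl⟩ := h.two_dvd
    have h1 := herm_even_zero_sq m
    rw [herm_odd_zero, Nat.mul_div_cancel_left _ two_pos, neg_zero, zero_pow two_ne_zero,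
      zero_div, add_zero, eq_div_iff (by positivity)]
    push_cast at hL ⊢
    rw [mul_div_assoc, mul_pow, hL]
    linear_combination (2 * (m : ℝ) + 1 / 2) * h1
  · obtain ⟨m, rfl⟩ := Nat.not_even_iff_odd.1 h
    have h1 := herm_even_zero_sq m
    rw [herm_odd_zero, show (2 * m + 1) / 2 = m by omega, zero_pow two_ne_zero, mul_zero,
      zero_add, show 2 * m + 1 + 1 = 2 * m + 2 by ring, herm_add_two, zero_mul, zero_sub,
      neg_neg, Nat.factorial_succ]
    have hfac : ((2 * m).factorial : ℝ) ≠ 0 := by positivity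
    push_cast at hL hLpos ⊢
    set L := √(2 * (m : ℝ) + 1 + 1 / 2)
    have e : ((2 * (m : ℝ) + 1) * herm (2 * m) 0) ^ 2 / L / ((2 * m + 1) * (2 * m).factorial) =
        (2 * m + 1) * (herm (2 * m) 0 ^ 2 / (2 * m).factorial) / L := by
      have : 2 * (m : ℝ) + 1 ≠ 0 := by positivity
      field_simp
    rw [e, div_pow, hL, div_mul_eq_mul_div, mul_pow]
    congr 1
    linear_combination (2 * (m : ℝ) + 1) * h1

theorem tendsto_action_zero :
    Tendsto (fun N : ℕ => action ((N : ℝ) + 1 / 2) (hermFun N) (hermFunDeriv N) 0 / N.factorial)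
      atTop (𝓝 √(2 / Real.pi)) := by
  have hratio : Tendsto (fun N : ℕ => if Even N then ((N : ℝ) + 1 / 2) / (N + 1)
      else N / ((N : ℝ) + 1 / 2)) atTop (𝓝 1) := by
    have h0 : Tendsto (fun N : ℕ => 1 - 1 / ((N : ℝ) + 1)) atTop (𝓝 1) := by
      simpa using (tendsto_one_div_add_atTop_nhds_zero_nat (𝕜 := ℝ)).const_sub 1
    refine tendsto_of_tendsto_of_tendsto_of_le_of_le h0 tendsto_const_nhds (fun N => ?_)
      fun N => ?_
    · dsimp only
      have hN : (0 : ℝ) ≤ N := N.cast_nonneg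
      split_ifs
      · rw [le_div_iff₀ (by positivity), sub_mul, one_div_mul_cancel (by positivity)]
        linarith
      · rw [sub_le_iff_le_add, div_add_div _ _ (by positivity) (by positivity),
          le_div_iff₀ (by positivity)]
        nlinarith
    · dsimp only
      have hN : (0 : ℝ) ≤ N := N.cast_nonneg
      split_ifs
      · rw [div_le_one (by positivity)]; linarith
      · rw [div_le_one (by positivity)]; linarith
  have hW : Tendsto (fun N : ℕ => Real.Wallis.W (N / 2)) atTop (𝓝 (Real.pi / 2)) :=
    Real.Wallis.tendsto_W_nhds_pi_div_two.comp (Nat.tendsto_div_const_atTop two_ne_zero)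
  have h := (hratio.div hW (by positivity)).sqrt
  rw [one_div_div] at h
  refine h.congr fun N => ?_
  simp only [Pi.div_apply]
  rw [← action_zero_sq, mul_div_cancel_right₀ _ (Real.Wallis.W_pos _).ne', Real.sqrt_sq]
  exact div_nonneg (action_nonneg _ _) (by positivity)

end

/-! ### Limits along sequences in the bulk -/

noncomputable section

open Filter Topology

/-- The turning-point parameter `N + 1/2` of the oscillator equation, for `N = n + 1`. -/
def level (n : ℕ) : ℝ := ((n + 1 : ℕ) : ℝ) + 1 / 2

theorem level_pos (n : ℕ) : 0 < level n := by unfold level; positivity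

theorem level_eq (n : ℕ) : level n = n + 3 / 2 := by unfold level; push_cast; ring

theorem tendsto_level : Tendsto level atTop atTop := by
  simp only [funext level_eq]
  exact tendsto_atTop_add_const_right _ _ tendsto_natCast_atTop_atTop

theorem tendsto_sqrt_level : Tendsto (fun n => √(level n)) atTop atTop :=
  Real.tendsto_sqrt_atTop.comp tendsto_level

/-- The normalized action of the Hermite function of degree `n + 1`. -/
def normAction (n : ℕ) (x : ℝ) : ℝ :=
  action (level n) (hermFun (n + 1)) (hermFunDeriv (n + 1)) x / (n + 1).factorial

theorem tendsto_normAction_zero : Tendsto (fun n => normAction n 0) atTop (𝓝 √(2 / Real.pi)) :=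
  tendsto_action_zero.comp (tendsto_add_atTop_nat 1)

theorem tendsto_const_div_level (C : ℝ) : Tendsto (fun n => C / level n) atTop (𝓝 0) :=
  tendsto_level.const_div_atTop C

/-- The bounds do not depend on `x`, so they also apply along radii varying with `n`. -/
theorem normAction_bounds {r : ℝ} (hr : 0 < r) : ∀ᶠ n in atTop, ∀ x, 0 ≤ x →
    x ^ 2 ≤ 4 * (1 - r ^ 2) * level n →
    normAction n 0 * Real.exp (-((1 / (2 * r ^ 3) + 3 / (2 * r ^ 5)) / level n)) /
        (1 + 1 / (4 * r ^ 3) / level n) ≤ normAction n x ∧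
      normAction n x ≤ normAction n 0 *
        Real.exp ((1 / (2 * r ^ 3) + 3 / (2 * r ^ 5)) / level n) /
          (1 - 1 / (4 * r ^ 3) / level n) := by
  have h := (tendsto_const_div_level (1 / (4 * r ^ 3))).eventually
    (eventually_le_nhds (show (0 : ℝ) < 1 / 2 by norm_num))
  filter_upwards [h] with n hn x hx hxl
  have hl := level_pos n
  have hb : 0 ≤ 1 / (4 * r ^ 3) / level n := by positivity
  have hfac : (0 : ℝ) < (n + 1).factorial := by positivity
  obtain ⟨h1, h2⟩ := action_bounds hr hl hx hxl (hasDerivAt_hermFun (n + 1))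
    (hasDerivAt_hermFunDeriv (n + 1)) (by rwa [div_div] at hn)
  rw [show 1 / (4 * r ^ 3 * level n) = 1 / (4 * r ^ 3) / level n by rw [div_div]] at h1 h2
  unfold normAction
  constructor
  · rw [div_le_iff₀ (by linarith), div_mul_eq_mul_div, div_mul_eq_mul_div]
    gcongr
  · rw [le_div_iff₀ (by linarith), div_mul_eq_mul_div, div_mul_eq_mul_div]
    gcongr

theorem tendsto_normAction_upper (r : ℝ) :
    Tendsto (fun n => normAction n 0 *
        Real.exp ((1 / (2 * r ^ 3) + 3 / (2 * r ^ 5)) / level n) /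
          (1 - 1 / (4 * r ^ 3) / level n)) atTop (𝓝 √(2 / Real.pi)) := by
  have h := (tendsto_normAction_zero.mul
    (tendsto_const_div_level (1 / (2 * r ^ 3) + 3 / (2 * r ^ 5))).rexp).div
    ((tendsto_const_div_level (1 / (4 * r ^ 3))).const_sub 1) (by norm_num)
  simpa [Pi.div_def] using h

theorem tendsto_normAction_lower (r : ℝ) :
    Tendsto (fun n => normAction n 0 *
        Real.exp (-((1 / (2 * r ^ 3) + 3 / (2 * r ^ 5)) / level n)) /
          (1 + 1 / (4 * r ^ 3) / level n)) atTop (𝓝 √(2 / Real.pi)) := by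
  have h := (tendsto_normAction_zero.mul
    (tendsto_const_div_level (1 / (2 * r ^ 3) + 3 / (2 * r ^ 5))).neg.rexp).div
    ((tendsto_const_div_level (1 / (4 * r ^ 3))).const_add 1) (by norm_num)
  simpa [Pi.div_def] using h

theorem exists_action_le {r : ℝ} (hr : 0 < r) : ∃ b : ℝ, ∀ᶠ n in atTop, ∀ x, 0 ≤ x →
    x ^ 2 ≤ 4 * (1 - r ^ 2) * level n →
    action (level n) (hermFun (n + 1)) (hermFunDeriv (n + 1)) x ≤ (n + 1).factorial * b := by
  refine ⟨√(2 / Real.pi) + 1, ?_⟩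
  filter_upwards [normAction_bounds hr, (tendsto_normAction_upper r).eventually
    (eventually_le_nhds (lt_add_one _))] with n h1 h2 x hx hxl
  have h := (h1 x hx hxl).2.trans h2
  rwa [normAction, div_le_iff₀' (by positivity)] at h

/-- A sequence of radii that stays in the bulk. -/
def InBulk (r : ℝ) (s : ℕ → ℝ) : Prop :=
  ∀ᶠ n in atTop, 0 < s n ∧ s n ^ 2 ≤ 4 * (1 - r ^ 2) * level n

theorem tendsto_normAction {r : ℝ} (hr : 0 < r) {s : ℕ → ℝ} (hs : InBulk r s) :
    Tendsto (fun n => normAction n (s n)) atTop (𝓝 √(2 / Real.pi)) := by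
  refine tendsto_of_tendsto_of_tendsto_of_le_of_le' (tendsto_normAction_lower r)
    (tendsto_normAction_upper r) ?_ ?_
  · filter_upwards [normAction_bounds hr, hs] with n h1 h2 using (h1 _ h2.1.le h2.2).1
  · filter_upwards [normAction_bounds hr, hs] with n h1 h2 using (h1 _ h2.1.le h2.2).2

theorem tendsto_weightedKernel {r A d : ℝ} (hr : 0 < r) {s t : ℕ → ℝ} (hs : InBulk r s)
    (ht : InBulk r t) (hst : Tendsto (fun n => |s n - t n|) atTop (𝓝 0))
    (hA : Tendsto (fun n => freq (level n) (t n) / √(level n)) atTop (𝓝 A))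
    (hd : Tendsto (fun n => freq (level n) (t n) * (s n - t n)) atTop (𝓝 d)) :
    Tendsto (fun n => weightedKernel (n + 1) (s n) (t n) / √(level n)) atTop
      (𝓝 (√(2 / Real.pi) * (A * Real.sinc d))) := by
  obtain ⟨b, hb⟩ := exists_action_le hr
  have hmain := (tendsto_normAction hr ht).mul
    (hA.mul ((Real.continuous_sinc.tendsto d).comp hd))
  have herr : Tendsto (fun n => b / r / √(level n) / √(level n) +
      2 * b / r * |s n - t n| / √(level n)) atTop (𝓝 0) := by
    have h1 := (tendsto_sqrt_level.const_div_atTop (b / r)).div_atTop tendsto_sqrt_level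
    have h2 := (hst.const_mul (2 * b / r)).div_atTop tendsto_sqrt_level
    simpa using h1.add h2
  have hdiff : Tendsto (fun n => weightedKernel (n + 1) (s n) (t n) / √(level n) -
      normAction n (t n) * (freq (level n) (t n) / √(level n) *
        Real.sinc (freq (level n) (t n) * (s n - t n)))) atTop (𝓝 0) := by
    refine squeeze_zero_norm' ?_ herr
    filter_upwards [hb, hs, ht] with n hbn hsn htn
    have hL : 0 < √(level n) := Real.sqrt_pos.2 (level_pos n)
    have hfac : (0 : ℝ) < (n + 1).factorial := by positivity
    have h := abs_weightedKernel_sub_le (N := n + 1) hr hsn.1.le htn.1.le hsn.2 htn.2 hbn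
    change |_ - action (level n) _ _ _ * (freq (level n) (t n) * Real.sinc
      (freq (level n) (t n) * (s n - t n)))| ≤ _ / (r * √(level n)) + _ at h
    have e : weightedKernel (n + 1) (s n) (t n) / √(level n) -
      normAction n (t n) * (freq (level n) (t n) / √(level n) *
        Real.sinc (freq (level n) (t n) * (s n - t n))) =
      ((n + 1).factorial * weightedKernel (n + 1) (s n) (t n) -
        action (level n) (hermFun (n + 1)) (hermFunDeriv (n + 1)) (t n) *
        (freq (level n) (t n) * Real.sinc (freq (level n) (t n) * (s n - t n)))) /
          ((n + 1).factorial * √(level n)) := by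
      rw [normAction]
      field_simp
    rw [e, Real.norm_eq_abs, abs_div, abs_of_pos (mul_pos hfac hL),
      div_le_iff₀ (mul_pos hfac hL)]
    refine h.trans (le_of_eq ?_)
    field_simp
  have := hdiff.add hmain
  rw [zero_add] at this
  refine this.congr fun n => ?_
  simp only [Function.comp_apply, sub_add_cancel]

theorem tendsto_weightedKernel_neg {r : ℝ} (hr : 0 < r) (hr1 : r ≤ 1) {s t : ℕ → ℝ}
    (hs : InBulk r s) (ht : InBulk r t) (hst : Tendsto (fun n => s n + t n) atTop atTop) :
    Tendsto (fun n => weightedKernel (n + 1) (s n) (-t n) / √(level n)) atTop (𝓝 0) := by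
  obtain ⟨b, hb⟩ := exists_action_le hr
  have herr : Tendsto (fun n => b / r / √(level n) / √(level n) +
      2 * b / r / (s n + t n) / √(level n)) atTop (𝓝 0) := by
    have h1 := (tendsto_sqrt_level.const_div_atTop (b / r)).div_atTop tendsto_sqrt_level
    have h2 := (hst.const_div_atTop (2 * b / r)).div_atTop tendsto_sqrt_level
    simpa using h1.add h2
  refine squeeze_zero_norm' ?_ herr
  filter_upwards [hb, hs, ht] with n hbn hsn htn
  have hL : 0 < √(level n) := Real.sqrt_pos.2 (level_pos n)
  have hfac : (0 : ℝ) < (n + 1).factorial := by positivity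
  have h := abs_weightedKernel_neg_le (N := n + 1) hr hr1 hsn.1 htn.1 hsn.2 htn.2 hbn
  change _ ≤ _ / (r * √(level n)) + _ at h
  rw [abs_mul, abs_of_pos hfac, ← le_div_iff₀' hfac] at h
  rw [Real.norm_eq_abs, abs_div, abs_of_pos hL, div_le_iff₀ hL]
  refine h.trans (le_of_eq ?_)
  have := (add_pos hsn.1 htn.1).ne'
  field_simp

/-- The two Hermite functions contribute `O(1 / √(level n))` after division by the factorial, and
the radii in the denominator give further decay. -/
theorem tendsto_correction {r : ℝ} (hr : 0 < r) (hr1 : r ≤ 1) {s t : ℕ → ℝ}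
    (hs : InBulk r s) (ht : InBulk r t) (hs' : Tendsto s atTop atTop)
    (ht' : Tendsto t atTop atTop) :
    Tendsto (fun n => herm (remDegree n) (s n) * herm (remDegree n) (t n) *
      Real.exp (-(s n ^ 2 + t n ^ 2) / 4) / (s n * t n * (remDegree n).factorial) / √(level n))
      atTop (𝓝 0) := by
  obtain ⟨b, hb⟩ := exists_action_le hr
  have hst := hs'.atTop_mul_atTop₀ ht'
  have herr : Tendsto (fun n => 4 * b / r / √(level n) / (s n * t n) / √(level n)) atTop
      (𝓝 0) :=
    ((tendsto_sqrt_level.const_div_atTop (4 * b / r)).div_atTop hst).div_atTop tendsto_sqrt_level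
  refine squeeze_zero_norm' ?_ herr
  filter_upwards [hb, hs, ht] with n hbn hsn htn
  have hl := level_pos n
  have hL : 0 < √(level n) := Real.sqrt_pos.2 hl
  have hLsq : √(level n) ^ 2 = level n := Real.sq_sqrt hl.le
  have hfac : (0 : ℝ) < (n + 1).factorial := by positivity
  have hstpos : 0 < s n * t n := mul_pos hsn.1 htn.1
  have hb0 : 0 ≤ b := by
    have := (action_nonneg _ _).trans (hbn _ hsn.1.le hsn.2)
    exact nonneg_of_mul_nonneg_right this hfac
  have hexp : Real.exp (-(s n ^ 2 + t n ^ 2) / 4) =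
      Real.exp (-s n ^ 2 / 4) * Real.exp (-t n ^ 2 / 4) := by
    rw [← Real.exp_add]; ring_nf
  have key : |hermFun (remDegree n) (s n) * hermFun (remDegree n) (t n)| ≤
      (remDegree n).factorial * (4 * b / r / √(level n)) := by
    rw [remDegree]
    split_ifs
    · refine (abs_mul_le_of_sq_le (sq_le_of_action_le hr hl hsn.2 (hbn _ hsn.1.le hsn.2)).1
        (sq_le_of_action_le hr hl htn.2 (hbn _ htn.1.le htn.2)).1).trans ?_
      change (n + 1).factorial * b / (r * √(level n)) ≤ _
      have : 0 ≤ b / r / √(level n) := by positivity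
      calc (n + 1).factorial * b / (r * √(level n)) =
            (n + 1).factorial * (b / r / √(level n)) := by field_simp
        _ ≤ (n + 1).factorial * (4 * (b / r / √(level n))) := by gcongr; linarith
        _ = _ := by ring
    · have h := abs_hermFun_succ_mul_le (N := n + 1) hr hr1 hsn.1.le htn.1.le hsn.2 htn.2 hbn
      refine h.trans ?_
      change 4 * ((n + 1).factorial * b) * √(level n) / r ≤ _
      rw [Nat.factorial_succ (n + 1)]
      -- The extra factor `level n = n + 3/2` lost by passing to degree `n + 2` is absorbed by the
      -- factor `n + 2` of its factorial.
      have hle : √(level n) ^ 2 ≤ ((n + 1 + 1 : ℕ) : ℝ) := by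
        rw [hLsq, level_eq]; push_cast; linarith
      have e1 : 4 * ((n + 1).factorial * b) * √(level n) / r =
          √(level n) ^ 2 * ((n + 1).factorial * (4 * b / r / √(level n))) := by
        field_simp
      rw [e1]
      push_cast at hle ⊢
      rw [mul_assoc]
      gcongr
  have hfac2 : (0 : ℝ) < (remDegree n).factorial := by positivity
  rw [Real.norm_eq_abs, abs_div, abs_of_pos hL]
  gcongr
  rw [abs_div, abs_of_pos (mul_pos hstpos hfac2), div_le_iff₀ (mul_pos hstpos hfac2), hexp]
  have e2 : herm (remDegree n) (s n) * herm (remDegree n) (t n) *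
      (Real.exp (-s n ^ 2 / 4) * Real.exp (-t n ^ 2 / 4)) =
      hermFun (remDegree n) (s n) * hermFun (remDegree n) (t n) := by
    unfold hermFun; ring
  rw [e2]
  refine key.trans (le_of_eq ?_)
  have h1 := hsn.1.ne'
  have h2 := htn.1.ne'
  field_simp

end

/-! ### The prescribed radii and the constants of the limit -/

noncomputable section

open Filter Topology

/-- The angle `φ + σ / (2 sin² φ) · 1/n` with `φ = arccos x₀`. -/
def angle (x₀ σ : ℝ) (n : ℕ) : ℝ :=
  Real.arccos x₀ + σ / (2 * Real.sin (Real.arccos x₀) ^ 2) * (1 / (n : ℝ))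

theorem radius_eq (x₀ σ : ℝ) (n : ℕ) :
    radius x₀ σ n = 2 * √(level n) * Real.cos (angle x₀ σ n) := by
  rw [radius, level_eq]; rfl

theorem tendsto_angle (x₀ σ : ℝ) : Tendsto (angle x₀ σ) atTop (𝓝 (Real.arccos x₀)) := by
  have h := ((tendsto_one_div_atTop_nhds_zero_nat (𝕜 := ℝ)).const_mul
    (σ / (2 * Real.sin (Real.arccos x₀) ^ 2))).const_add (Real.arccos x₀)
  rwa [mul_zero, add_zero] at h

theorem tendsto_cos_angle {x₀ : ℝ} (h0 : 0 < x₀) (h1 : x₀ < 1) (σ : ℝ) :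
    Tendsto (fun n => Real.cos (angle x₀ σ n)) atTop (𝓝 x₀) := by
  have h := (Real.continuous_cos.tendsto _).comp (tendsto_angle x₀ σ)
  rwa [Real.cos_arccos (by linarith) h1.le] at h

theorem tendsto_sin_angle (x₀ σ : ℝ) :
    Tendsto (fun n => Real.sin (angle x₀ σ n)) atTop (𝓝 (Real.sin (Real.arccos x₀))) :=
  (Real.continuous_sin.tendsto _).comp (tendsto_angle x₀ σ)

theorem sin_arccos_pos {x₀ : ℝ} (h0 : 0 < x₀) (h1 : x₀ < 1) : 0 < Real.sin (Real.arccos x₀) := by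
  rw [Real.sin_arccos]
  exact Real.sqrt_pos.2 (by nlinarith)

/-- This is the derivative of `cos (φ + a h)` at `h = 0`, sampled at `h = 1 / n`. -/
theorem tendsto_mul_cos_angle_sub {x₀ : ℝ} (h0 : 0 < x₀) (h1 : x₀ < 1) (σ : ℝ) :
    Tendsto (fun n : ℕ => (n : ℝ) * (Real.cos (angle x₀ σ n) - x₀)) atTop
      (𝓝 (-(σ / (2 * Real.sin (Real.arccos x₀))))) := by
  set φ := Real.arccos x₀ with hφ
  set a := σ / (2 * Real.sin φ ^ 2) with ha
  have hs := sin_arccos_pos h0 h1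
  rw [← hφ] at hs
  have hd : HasDerivAt (fun h => Real.cos (φ + a * h)) (-(σ / (2 * Real.sin φ))) 0 := by
    have h := (((hasDerivAt_id (0 : ℝ)).const_mul a).const_add φ).cos
    refine h.congr_deriv ?_
    simp only [id, mul_zero, add_zero]
    rw [ha]
    field_simp
  have hlim : Tendsto (fun n : ℕ => 1 / (n : ℝ)) atTop (𝓝[≠] 0) := by
    refine tendsto_nhdsWithin_iff.2 ⟨tendsto_one_div_atTop_nhds_zero_nat, ?_⟩
    filter_upwards [eventually_gt_atTop 0] with n hn
    have : (0 : ℝ) < n := by exact_mod_cast hn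
    exact (one_div_pos.2 this).ne'
  refine ((hasDerivAt_iff_tendsto_slope_zero.1 hd).comp hlim).congr fun n => ?_
  simp only [Function.comp_apply, zero_add, mul_zero, add_zero, smul_eq_mul, one_div, inv_inv]
  rw [hφ, Real.cos_arccos (by linarith) h1.le, angle, one_div]

theorem tendsto_level_div : Tendsto (fun n : ℕ => level n / n) atTop (𝓝 1) := by
  have h := (tendsto_const_div_atTop_nhds_zero_nat (3 / 2 : ℝ)).const_add 1
  rw [add_zero] at h
  refine h.congr' ?_
  filter_upwards [eventually_gt_atTop 0] with n hn
  have : (n : ℝ) ≠ 0 := by positivity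
  rw [level_eq]
  field_simp

theorem tendsto_level_mul_cos_sub {x₀ : ℝ} (h0 : 0 < x₀) (h1 : x₀ < 1) (σ τ : ℝ) :
    Tendsto (fun n : ℕ => level n * (Real.cos (angle x₀ σ n) - Real.cos (angle x₀ τ n))) atTop
      (𝓝 ((τ - σ) / (2 * Real.sin (Real.arccos x₀)))) := by
  have h := tendsto_level_div.mul
    ((tendsto_mul_cos_angle_sub h0 h1 σ).sub (tendsto_mul_cos_angle_sub h0 h1 τ))
  have e : 1 * (-(σ / (2 * Real.sin (Real.arccos x₀))) -
      -(τ / (2 * Real.sin (Real.arccos x₀)))) = (τ - σ) / (2 * Real.sin (Real.arccos x₀)) := by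
    ring
  rw [e] at h
  refine h.congr' ?_
  filter_upwards [eventually_gt_atTop 0] with n hn
  have : (n : ℝ) ≠ 0 := by positivity
  field_simp
  ring

theorem exists_inBulk_radius {x₀ : ℝ} (h0 : 0 < x₀) (h1 : x₀ < 1) :
    ∃ r : ℝ, 0 < r ∧ r ≤ 1 ∧ ∀ σ, InBulk r (radius x₀ σ) := by
  have hx : x₀ ^ 2 < 1 := by nlinarith
  -- With this choice `1 - r ^ 2 = (1 + x₀ ^ 2) / 2`, halfway between `x₀ ^ 2` and `1`, which leaves
  -- room for the `1/n` perturbation of the angle.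
  refine ⟨√((1 - x₀ ^ 2) / 2), Real.sqrt_pos.2 (by linarith), ?_, fun σ => ?_⟩
  · rw [Real.sqrt_le_one]
    nlinarith [sq_nonneg x₀]
  · have hc := tendsto_cos_angle h0 h1 σ
    filter_upwards [hc.eventually (eventually_gt_nhds h0),
      (hc.pow 2).eventually (eventually_le_nhds (show x₀ ^ 2 < (1 + x₀ ^ 2) / 2 by linarith))]
      with n hn1 hn2
    have hl := level_pos n
    have hL := Real.sqrt_pos.2 hl
    rw [radius_eq, Real.sq_sqrt (by linarith)]
    refine ⟨by positivity, ?_⟩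
    rw [mul_pow, mul_pow, Real.sq_sqrt hl.le]
    nlinarith

theorem tendsto_radius {x₀ : ℝ} (h0 : 0 < x₀) (h1 : x₀ < 1) (σ : ℝ) :
    Tendsto (radius x₀ σ) atTop atTop := by
  rw [funext (radius_eq x₀ σ)]
  exact (tendsto_sqrt_level.const_mul_atTop two_pos).atTop_mul_pos h0 (tendsto_cos_angle h0 h1 σ)

theorem eventually_freq_radius {x₀ : ℝ} (h0 : 0 < x₀) (h1 : x₀ < 1) (τ : ℝ) :
    ∀ᶠ n in atTop, freq (level n) (radius x₀ τ n) = √(level n) * Real.sin (angle x₀ τ n) := by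
  filter_upwards [(tendsto_sin_angle x₀ τ).eventually
    (eventually_gt_nhds (sin_arccos_pos h0 h1))] with n hn
  have hl := level_pos n
  rw [freq, radius_eq, mul_pow, mul_pow, Real.sq_sqrt hl.le, Real.cos_sq']
  rw [show level n - 2 ^ 2 * level n * (1 - Real.sin (angle x₀ τ n) ^ 2) / 4 =
    level n * Real.sin (angle x₀ τ n) ^ 2 by ring, Real.sqrt_mul hl.le, Real.sqrt_sq hn.le]

/-- The frequency is `√l` times the sine of the angle, and the radii differ by about `(τ - σ) / (√l
sin φ)`. Their product tends to `τ - σ`, which explains the `2 sin² φ` in the scaling. -/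
theorem tendsto_weightedKernel_radius {x₀ : ℝ} (h0 : 0 < x₀) (h1 : x₀ < 1) (σ τ : ℝ) :
    Tendsto (fun n => weightedKernel (n + 1) (radius x₀ σ n) (radius x₀ τ n) / √(level n)) atTop
      (𝓝 (√(2 / Real.pi) * (Real.sin (Real.arccos x₀) * Real.sinc (τ - σ)))) := by
  obtain ⟨r, hr, -, hbulk⟩ := exists_inBulk_radius h0 h1
  have hs := sin_arccos_pos h0 h1
  refine tendsto_weightedKernel hr (hbulk σ) (hbulk τ) ?_ ?_ ?_
  · have h := (((tendsto_level_mul_cos_sub h0 h1 σ τ).const_mul 2).div_atTop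
      tendsto_sqrt_level).abs
    rw [abs_zero] at h
    refine h.congr fun n => ?_
    have hL := Real.sqrt_pos.2 (level_pos n)
    rw [radius_eq, radius_eq]
    congr 1
    rw [div_eq_iff hL.ne']
    nth_rewrite 1 [← Real.sq_sqrt (level_pos n).le]
    ring
  · refine (tendsto_sin_angle x₀ τ).congr' ?_
    filter_upwards [eventually_freq_radius h0 h1 τ] with n hn
    rw [hn, mul_div_cancel_left₀ _ (Real.sqrt_pos.2 (level_pos n)).ne']
  · have h := ((tendsto_sin_angle x₀ τ).mul (tendsto_level_mul_cos_sub h0 h1 σ τ)).const_mul 2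
    rw [show 2 * (Real.sin (Real.arccos x₀) * ((τ - σ) / (2 * Real.sin (Real.arccos x₀)))) =
      τ - σ by field_simp] at h
    refine h.congr' ?_
    filter_upwards [eventually_freq_radius h0 h1 τ] with n hn
    rw [hn, radius_eq, radius_eq]
    nth_rewrite 1 [← Real.sq_sqrt (level_pos n).le]
    ring

theorem sqrt_density_mul (s t : ℝ) : √(density s * density t) =
    (2 * Real.pi) ^ (-(3 / 2 : ℝ)) * Real.exp (-(s ^ 2 + t ^ 2) / 4) := by
  have hpi : 0 < 2 * Real.pi := by positivity
  rw [Real.sqrt_eq_iff_mul_self_eq (mul_nonneg (density_pos s).le (density_pos t).le)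
    (by positivity), density, density]
  have h : Real.exp (-(s ^ 2 + t ^ 2) / 4) * Real.exp (-(s ^ 2 + t ^ 2) / 4) =
      Real.exp (-s ^ 2 / 2) * Real.exp (-t ^ 2 / 2) := by
    rw [← Real.exp_add, ← Real.exp_add]; ring_nf
  linear_combination -((2 * Real.pi) ^ (-(3 / 2 : ℝ))) ^ 2 * h

/-- The sine from the amplitude and the `x₀ ^ 2` from `level / (s t)` cancel against `limitDensity`;
the final `1/2` comes from taking the odd or even half of the Hermite kernel. -/
theorem limit_constant {x₀ : ℝ} (h0 : 0 < x₀) (h1 : x₀ < 1) (c : ℝ) :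
    (2 * Real.pi) ^ (-(3 / 2 : ℝ)) / limitDensity x₀ *
      (√(2 / Real.pi) * (Real.sin (Real.arccos x₀) * c)) * (1 / (4 * (x₀ * x₀))) = c / 2 := by
  have hs := sin_arccos_pos h0 h1
  rw [limitDensity, ← Real.sin_arccos]
  have hpi := Real.pi_pos
  have e1 : (2 * Real.pi) ^ (-(3 / 2 : ℝ)) = 1 / (2 * Real.pi * √(2 * Real.pi)) := by
    rw [Real.rpow_neg (by positivity), show (3 / 2 : ℝ) = 1 + 1 / 2 by norm_num,
      Real.rpow_add (by positivity), Real.rpow_one, Real.sqrt_eq_rpow, inv_eq_one_div]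
  have e2 : √(2 / Real.pi) * √(2 * Real.pi) = 2 := by
    rw [← Real.sqrt_mul (by positivity), show 2 / Real.pi * (2 * Real.pi) = 2 ^ 2 by
      field_simp, Real.sqrt_sq (by norm_num)]
  have e3 : √(2 * Real.pi) ^ 2 = 2 * Real.pi := Real.sq_sqrt (by positivity)
  have e4 : √(2 / Real.pi) = 2 / √(2 * Real.pi) := by
    rw [eq_div_iff (by positivity), e2]
  rw [e1, e4]
  field_simp
  rw [e3]
  ring

theorem tendsto_level_div_radius_mul {x₀ : ℝ} (h0 : 0 < x₀) (h1 : x₀ < 1) (σ τ : ℝ) :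
    Tendsto (fun n => level n / (radius x₀ σ n * radius x₀ τ n)) atTop
      (𝓝 (1 / (4 * (x₀ * x₀)))) := by
  have h := (((tendsto_cos_angle h0 h1 σ).mul (tendsto_cos_angle h0 h1 τ)).const_mul 4).inv₀
    (by positivity)
  rw [← one_div] at h
  refine h.congr fun n => ?_
  have hl := level_pos n
  rw [radius_eq, radius_eq, show 2 * √(level n) * Real.cos (angle x₀ σ n) *
    (2 * √(level n) * Real.cos (angle x₀ τ n)) = √(level n) ^ 2 *
      (4 * (Real.cos (angle x₀ σ n) * Real.cos (angle x₀ τ n))) by ring, Real.sq_sqrt hl.le,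
    div_mul_eq_div_div, div_self hl.ne', one_div]

/-- The scalar factor in the rescaled kernel. -/
def rescaling (x₀ σ τ : ℝ) (n : ℕ) : ℝ :=
  2 * √((n : ℝ) + 3 / 2) / limitDensity x₀ * √(density (radius x₀ σ n) * density (radius x₀ τ n))

theorem tendsto_evenKernel {x₀ : ℝ} (h0 : 0 < x₀) (h1 : x₀ < 1) (σ τ : ℝ) :
    Tendsto (fun n => rescaling x₀ σ τ n * evenKernel n (radius x₀ σ n) (radius x₀ τ n)) atTop
      (𝓝 (Real.sinc (τ - σ) / 2)) := by
  obtain ⟨r, hr, hr1, hbulk⟩ := exists_inBulk_radius h0 h1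
  have hneg := tendsto_weightedKernel_neg hr hr1 (hbulk σ) (hbulk τ)
    ((tendsto_radius h0 h1 σ).atTop_add_atTop (tendsto_radius h0 h1 τ))
  have h := (((tendsto_weightedKernel_radius h0 h1 σ τ).sub hneg).const_mul
    ((2 * Real.pi) ^ (-(3 / 2 : ℝ)) / limitDensity x₀)).mul
    (tendsto_level_div_radius_mul h0 h1 σ τ)
  rw [sub_zero, limit_constant h0 h1] at h
  refine h.congr' ?_
  filter_upwards [hbulk σ, hbulk τ] with n hs ht
  have hs' := hs.1.ne'
  have ht' := ht.1.ne'
  have hL := (Real.sqrt_pos.2 (level_pos n)).ne'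
  have e := mul_evenKernel n hs' ht'
  have e' : evenKernel n (radius x₀ σ n) (radius x₀ τ n) = _ / _ :=
    eq_div_of_mul_eq (mul_ne_zero hs' ht') ((mul_comm _ _).trans e)
  rw [rescaling, e', sqrt_density_mul, weightedKernel, weightedKernel, neg_sq, ← level_eq]
  nth_rewrite 3 [← Real.sq_sqrt (level_pos n).le]
  field_simp

theorem tendsto_oddKernel {x₀ : ℝ} (h0 : 0 < x₀) (h1 : x₀ < 1) (σ τ : ℝ) :
    Tendsto (fun n => rescaling x₀ σ τ n * oddKernel n (radius x₀ σ n) (radius x₀ τ n)) atTop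
      (𝓝 (Real.sinc (τ - σ) / 2)) := by
  obtain ⟨r, hr, hr1, hbulk⟩ := exists_inBulk_radius h0 h1
  have hneg := tendsto_weightedKernel_neg hr hr1 (hbulk σ) (hbulk τ)
    ((tendsto_radius h0 h1 σ).atTop_add_atTop (tendsto_radius h0 h1 τ))
  have hcorr := tendsto_correction hr hr1 (hbulk σ) (hbulk τ) (tendsto_radius h0 h1 σ)
    (tendsto_radius h0 h1 τ)
  have h := ((((tendsto_weightedKernel_radius h0 h1 σ τ).add hneg).sub
    (hcorr.const_mul 2)).const_mul
    ((2 * Real.pi) ^ (-(3 / 2 : ℝ)) / limitDensity x₀)).mul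
    (tendsto_level_div_radius_mul h0 h1 σ τ)
  rw [add_zero, mul_zero, sub_zero, limit_constant h0 h1] at h
  refine h.congr' ?_
  filter_upwards [hbulk σ, hbulk τ] with n hs ht
  have hs' := hs.1.ne'
  have ht' := ht.1.ne'
  have hL := (Real.sqrt_pos.2 (level_pos n)).ne'
  have e := mul_oddKernel n hs' ht'
  have e' : oddKernel n (radius x₀ σ n) (radius x₀ τ n) = _ / _ :=
    eq_div_of_mul_eq (mul_ne_zero hs' ht') ((mul_comm _ _).trans e)
  rw [rescaling, e', sqrt_density_mul, weightedKernel, weightedKernel, neg_sq, ← level_eq]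
  have hfac : ((remDegree n).factorial : ℝ) ≠ 0 := by positivity
  generalize Real.exp (-(radius x₀ σ n ^ 2 + radius x₀ τ n ^ 2) / 4) = E
  generalize hermKernel (n + 1) (radius x₀ σ n) (radius x₀ τ n) = K
  generalize hermKernel (n + 1) (radius x₀ σ n) (-radius x₀ τ n) = K'
  generalize herm (remDegree n) (radius x₀ σ n) = a
  generalize herm (remDegree n) (radius x₀ τ n) = a'
  have hsq := Real.sq_sqrt (level_pos n).le
  generalize √(level n) = L at hL hsq ⊢
  rw [← hsq]
  field_simp

end

end Ginibre3D

theorem mainTheorem4 (ε x₀ : ℝ) (hε : 0 < ε) (hx₀ : x₀ ∈ Set.Icc ε (1 - ε)) (σ τ : ℝ)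
    (u v : Ginibre3D.Space) (hu : u ∈ Metric.sphere (0 : Ginibre3D.Space) 1)
    (hv : v ∈ Metric.sphere (0 : Ginibre3D.Space) 1) :
    Filter.Tendsto (fun n : ℕ => Ginibre3D.rescaledKernel n u σ v τ x₀) Filter.atTop
      (nhds (Ginibre3D.limitKernel u σ v τ)) := by
  have h0 : 0 < x₀ := hε.trans_le hx₀.1
  have h1 : x₀ < 1 := by linarith [hx₀.2]
  have hu1 : ‖u‖ = 1 := by simpa using hu
  have hv1 : ‖v‖ = 1 := by simpa using hv
  obtain ⟨r, -, -, hbulk⟩ := Ginibre3D.exists_inBulk_radius h0 h1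
  have h := ((Ginibre3D.tendsto_evenKernel h0 h1 σ τ).smul_const (1 : ℍ[ℝ])).sub
    ((Ginibre3D.tendsto_oddKernel h0 h1 σ τ).smul_const
      (Ginibre3D.toQuat u * Ginibre3D.toQuat v))
  have e : Ginibre3D.limitKernel u σ v τ = (Real.sinc (τ - σ) / 2) • (1 : ℍ[ℝ]) -
      (Real.sinc (τ - σ) / 2) • (Ginibre3D.toQuat u * Ginibre3D.toQuat v) := by
    have h2 : (2 : ℍ[ℝ]) = algebraMap ℝ ℍ[ℝ] 2 := (map_ofNat _ 2).symm
    rw [Ginibre3D.limitKernel, h2, div_eq_mul_inv, ← map_inv₀, ← Algebra.commutes,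
      ← Algebra.smul_def]
    module
  rw [e]
  refine h.congr' ?_
  -- The ray decomposition divides by the radii, which are nonzero only for large `n`.
  filter_upwards [hbulk σ, hbulk τ] with n hs ht
  rw [Ginibre3D.rescaledKernel, Ginibre3D.kernel_smul_smul hu1 hv1 hs.1.ne' ht.1.ne', smul_sub,
    smul_smul, smul_smul]
  rfl
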